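/- Let $k$ be an infinite field, $S=k[x_0,\dots,x_n]$, and let $I\subset S$ be an ideal of codimension at least $2$ generated by an $(r+1)$-dimensional vector space $W$ of forms of the same degree, with basis $f_0,\dots,f_r$. Let $\phi:\mathbf P^n\dashrightarrow\mathbf P^r=\mathbf P(W)$ be the associated rational map, which is a morphism on $\mathbf P^n\setminus V(I)$, and let $\ell(I)=1+\dim\overline{\phi(\mathbf P^n\setminus V(I))}$ be the analytic spread of $I$. A $k$-rational point $q$ of $\mathbf P(W)$ is a subspace $W_q\subset W$ of codimension $1$; write $I_q\subset S$ for the ideal generated by $W_q$. For a $k$-rational point $p\in\mathbf P^n\setminus V(I)$, the point $\phi(p)$ is given by $W_{\phi(p)}=\{h\in W: h(p)=0\}$. Put $I_q:I^\infty=\bigcup_m (I_q:I^m)$ (the morphism fiber ideal of $q$); the ideal $I_q:I$ is the row ideal of $q$. An ideal is called linear if it is generated by linear forms. "For a general point $p$" means: for all $k$-rational points $p$ of some non-empty Zariski open subset of $\mathbf P^n$ (contained in $\mathbf P^n\setminus V(I)$). (a) If $q$ is a $k$-rational point of $\mathbf P(W)$ with $I_q:I^\infty\neq S$, then $\ell(I)\ge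 1+\operatorname{codim}(I_q:I^\infty)$. (b) For a general point $p$ of $\mathbf P^n$, $\ell(I)=1+\operatorname{codim}(I_{\phi(p)}:I^\infty)$. (c) If there is a $k$-rational point $q$ of $\mathbf P(W)$ such that the row ideal $I_q:I$ is linear of codimension $n$ and does not contain $I$, then $\phi$ is birational onto its image. Moreover, $\phi$ is birational onto its image if and only if $I_{\phi(p)}:I^\infty$ is a linear ideal of codimension $n$ for a general point $p$ of $\mathbf P^n$. -/

import Mathlib

open MvPolynomial

noncomputable section

namespace RowIdeals

attribute [local instance] MvPolynomial.gradedAlgebra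

variable {k : Type*} [Field k] {n r : ℕ}

/-- Projective `m`-space over `k` with its Zariski topology: the relevant homogeneous primes of
`k[x_0, ..., x_m]`. -/
abbrev ProjSpace (k : Type*) [Field k] (m : ℕ) : Type _ :=
  ProjectiveSpectrum (homogeneousSubmodule (Fin (m + 1)) k)

/-- The vector space `W` spanned by the forms `f_0, ..., f_r`. -/
def formSpace (f : Fin (r + 1) → MvPolynomial (Fin (n + 1)) k) :
    Submodule k (MvPolynomial (Fin (n + 1)) k) :=
  Submodule.span k (Set.range f)

/-- The ideal `I` generated by `f_0, ..., f_r`. -/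
def formIdeal (f : Fin (r + 1) → MvPolynomial (Fin (n + 1)) k) :
    Ideal (MvPolynomial (Fin (n + 1)) k) :=
  Ideal.span (Set.range f)

/-! ### Rational points and the ideals attached to them -/

/-- A `k`-rational point `q` of `P(W)`: a subspace `W_q` of `W` of codimension one. -/
structure TargetPoint (W : Submodule k (MvPolynomial (Fin (n + 1)) k)) where
  /-- The subspace `W_q`. -/
  space : Submodule k (MvPolynomial (Fin (n + 1)) k)
  space_le : space ≤ W
  finrank_add_one : Module.finrank k space + 1 = Module.finrank k W

/-- The ideal `I_q` generated by `W_q`. -/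
def TargetPoint.ideal {W : Submodule k (MvPolynomial (Fin (n + 1)) k)} (q : TargetPoint W) :
    Ideal (MvPolynomial (Fin (n + 1)) k) :=
  Ideal.span (q.space : Set (MvPolynomial (Fin (n + 1)) k))

/-- The saturation `J : I^∞`, the union of the ideals `J : I^m`. -/
def saturation {R : Type*} [CommRing R] (J I : Ideal R) : Ideal R :=
  ⨆ m : ℕ, J.colon ((I ^ m : Ideal R) : Set R)

/-- The generalized row ideal `I_q : I`. -/
def rowIdeal (f : Fin (r + 1) → MvPolynomial (Fin (n + 1)) k) (q : TargetPoint (formSpace f)) :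
    Ideal (MvPolynomial (Fin (n + 1)) k) :=
  q.ideal.colon (formIdeal f : Set (MvPolynomial (Fin (n + 1)) k))

/-- The morphism fiber ideal `I_q : I^∞`. -/
def morphismFiberIdeal (f : Fin (r + 1) → MvPolynomial (Fin (n + 1)) k)
    (q : TargetPoint (formSpace f)) : Ideal (MvPolynomial (Fin (n + 1)) k) :=
  saturation q.ideal (formIdeal f)

/-- A linear ideal: an ideal generated by linear forms. -/
def IsLinearIdeal (J : Ideal (MvPolynomial (Fin (n + 1)) k)) : Prop :=
  ∃ s : Set (MvPolynomial (Fin (n + 1)) k), (∀ l ∈ s, l.IsHomogeneous 1) ∧ J = Ideal.span s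

/-- The `k`-rational point `p` of `P^n` lies outside `V(I)`. -/
def IsRegularAt (f : Fin (r + 1) → MvPolynomial (Fin (n + 1)) k)
    (p : Projectivization k (Fin (n + 1) → k)) : Prop :=
  ∃ i, eval p.rep (f i) ≠ 0

/-- The image `φ(p)` of a `k`-rational point `p` outside `V(I)`: the subspace of those elements
of `W` that vanish at `p`. -/
def imagePoint (f : Fin (r + 1) → MvPolynomial (Fin (n + 1)) k)
    (p : Projectivization k (Fin (n + 1) → k)) (hp : IsRegularAt f p) :
    TargetPoint (formSpace f) where
  space := formSpace f ⊓ LinearMap.ker (aeval p.rep : _ →ₐ[k] k).toLinearMap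
  space_le := inf_le_left
  finrank_add_one := by
    obtain ⟨i, hi⟩ := hp
    have : FiniteDimensional k (formSpace f) :=
      FiniteDimensional.span_of_finite k (Set.finite_range f)
    let e : Module.Dual k (formSpace f) :=
      (aeval p.rep : MvPolynomial (Fin (n + 1)) k →ₐ[k] k).toLinearMap ∘ₗ (formSpace f).subtype
    have he : e ≠ 0 := fun h => hi (by
      have := LinearMap.congr_fun h ⟨f i, Submodule.subset_span ⟨i, rfl⟩⟩
      simpa [e, aeval_eq_eval] using this)
    rw [← Module.Dual.finrank_ker_add_one_of_ne_zero he]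
    congr 1
    rw [show LinearMap.ker e = (LinearMap.ker
      (aeval p.rep : MvPolynomial (Fin (n + 1)) k →ₐ[k] k).toLinearMap).comap
        (formSpace f).subtype from LinearMap.ker_comp _ _]
    rw [← Submodule.map_comap_subtype, Submodule.finrank_map_subtype_eq]

/-- `P` holds for a general point of `P^n`: it holds for all `k`-rational points of some non-empty
Zariski open subset. (Every non-empty open subset contains the locus `g ≠ 0` of some
non-zero form `g`.) -/
def ForGeneralPoint (P : Projectivization k (Fin (n + 1) → k) → Prop) : Prop :=
  ∃ (g : MvPolynomial (Fin (n + 1)) k) (e : ℕ), g ≠ 0 ∧ g.IsHomogeneous e ∧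
    ∀ p : Projectivization k (Fin (n + 1) → k), eval p.rep g ≠ 0 → P p

/-! ### The rational map, its image and the analytic spread -/

/-- The morphism `φ : P^n ∖ V(I) → P^r` on all (scheme-theoretic) points: `φ(x)` is the prime
generated by the forms `G` with `G(f_0, ..., f_r) ∈ x`. -/
def ratMap (f : Fin (r + 1) → MvPolynomial (Fin (n + 1)) k) (x : ProjSpace k n)
    (hx : ∃ i, f i ∉ x.asHomogeneousIdeal.toIdeal) : ProjSpace k r where
  asHomogeneousIdeal :=
    (x.asHomogeneousIdeal.toIdeal.comap (bind₁ f)).homogeneousCore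
      (homogeneousSubmodule (Fin (r + 1)) k)
  isPrime := (x.isPrime.comap (bind₁ f)).homogeneousCore
  not_irrelevant_le := by
    obtain ⟨i, hi⟩ := hx
    intro h
    have hX : (X i : MvPolynomial (Fin (r + 1)) k) ∈
        HomogeneousIdeal.irrelevant (homogeneousSubmodule (Fin (r + 1)) k) :=
      HomogeneousIdeal.mem_irrelevant_of_mem _ one_pos (isHomogeneous_X k i)
    have := Ideal.toIdeal_homogeneousCore_le _ _ (h hX)
    simp at this
    exact hi this

/-- The set-theoretic image `φ(P^n ∖ V(I))` in `P^r`. -/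
def ratImage (f : Fin (r + 1) → MvPolynomial (Fin (n + 1)) k) : Set (ProjSpace k r) :=
  {y | ∃ (x : ProjSpace k n) (hx : ∃ i, f i ∉ x.asHomogeneousIdeal.toIdeal), ratMap f x hx = y}

/-- The analytic spread `ℓ(I)`: one plus the dimension of the (closed) image of `φ`. -/
def analyticSpread (f : Fin (r + 1) → MvPolynomial (Fin (n + 1)) k) : WithBot ℕ∞ :=
  1 + topologicalKrullDim (closure (ratImage f))

/-- The homogeneous ideal of the (closed) image of `φ`. -/
def imageIdeal (f : Fin (r + 1) → MvPolynomial (Fin (n + 1)) k) :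
    Ideal (MvPolynomial (Fin (r + 1)) k) :=
  (ProjectiveSpectrum.vanishingIdeal (ratImage f)).toIdeal

/-- A tuple `g` represents a rational map from the projective variety with homogeneous prime ideal
`P`: its entries are forms of one degree, not all of them vanishing on the variety. -/
def RepresentsRatMap {m s : ℕ} (P : Ideal (MvPolynomial (Fin (m + 1)) k))
    (g : Fin (s + 1) → MvPolynomial (Fin (m + 1)) k) : Prop :=
  (∃ e : ℕ, ∀ i, (g i).IsHomogeneous e) ∧ ∃ i, g i ∉ P

/-- Two tuples represent the same rational map from the projective variety with homogeneous prime
ideal `P`: both represent one, and they are proportional on the variety. -/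
def SameRatMap {m s : ℕ} (P : Ideal (MvPolynomial (Fin (m + 1)) k))
    (g h : Fin (s + 1) → MvPolynomial (Fin (m + 1)) k) : Prop :=
  RepresentsRatMap P g ∧ RepresentsRatMap P h ∧ ∀ i j, g i * h j - g j * h i ∈ P

/-- `φ` is birational onto its image: there is a rational map `ψ`, represented by `g`, from the
closed image of `φ` to `P^n` such that `ψ ∘ φ` is the identity of `P^n` and `φ ∘ ψ` is the identity
of the image, as rational maps. -/
def IsBirationalOntoImage (f : Fin (r + 1) → MvPolynomial (Fin (n + 1)) k) : Prop :=
  ∃ g : Fin (n + 1) → MvPolynomial (Fin (r + 1)) k,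
    RepresentsRatMap (imageIdeal f) g ∧
    SameRatMap ⊥ (fun i => bind₁ f (g i)) X ∧
    SameRatMap (imageIdeal f) (fun i => bind₁ g (f i)) X

end RowIdeals

end

/-! Write `S` for the polynomial ring. Pick `h` in `W` outside `W_q`. Then `I = I_q + (h)`, so `I_q
: I^∞` is the contraction of `I_q S_h`, and `h` is a linear form `l` evaluated at `f`. Let `B =
k[f_j / h]` inside `S_h`, the ring of the chart `l ≠ 0` of the image.

(a) If `Q` is a minimal prime of `I_q S_h`, then `I_q S_h` lies in `(Q ∩ B) S_h`, so `Q` is also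
minimal over the latter and `ht Q ≤ ht (Q ∩ B) ≤ dim B`. The dimension of a chart is at most that of
the image (`height_map_ideal_le`, `ringKrullDim_range_ratioHom_le`).

(b) The opposite inequality at a general point is the lower bound for the codimension of general
fibres. Two Noether normalizations reduce it to going-down over a polynomial ring
(`exists_ne_zero_forall_ringKrullDim_le_height`). It is applied in every chart `f_i ≠ 0`, and these
charts compute the dimension of the image.

(c) A linear ideal of codimension `n` is the ideal of a rational point `p`. If it is the row ideal,
the products `(p_i x_j - p_j x_i) h` are combinations of the variables with coefficients in `W_q`.
This is a linear system for the `x_j` whose matrix is linear in the `f`, and Cramer's rule solves it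
for `x` up to a common factor (`isBirationalOntoImage_of_rowIdeal`).

For the equivalence, an inverse `g` of degree `e` gives `f_i^e (p_a x_b - p_b x_a) ∈ I_φ(p)`,
because modulo `I_φ(p)` the tuple `f` is proportional to `f(p)`. Conversely, pass to the affine cone
map with coordinate ring `A ⊂ S`. The hypothesis says that the scheme-theoretic fibre through a
general rational point is that reduced point. A height count makes `S` algebraic over `A`, and
Nakayama's lemma then puts the variables into the fraction field of `A`
(`exists_ne_zero_forall_exists_mul_mem`). Since the whole fibre ring is controlled, and not just its
points, inseparability causes no trouble. -/

noncomputable section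

/-! ### Heights and dimension under integral, going-down and birational extensions. -/

section CommutativeAlgebra

/-- Induction on the variables: contracting to one variable fewer keeps maximality by the Jacobson
property, and the height drops by exactly one. -/
theorem MvPolynomial.height_of_isMaximal {k : Type*} [Field k] (s : ℕ)
    (M : Ideal (MvPolynomial (Fin s) k)) [M.IsMaximal] : M.height = s := by
  induction s with
  | zero =>
    have h : (M.height : WithBot ℕ∞) ≤ ringKrullDim (MvPolynomial (Fin 0) k) :=
      Ideal.height_le_ringKrullDim_of_isPrime
    rw [MvPolynomial.ringKrullDim_of_isNoetherianRing, ringKrullDim_eq_zero_of_field] at h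
    have h' : M.height ≤ 0 := by exact_mod_cast (by simpa using h)
    simpa using h'
  | succ s ih =>
    let e := (finSuccEquiv k s).toRingEquiv
    rw [← e.symm.height_comap M]
    set M' := M.comap e.symm with hM'
    have : M'.IsMaximal := Ideal.comap_isMaximal_of_equiv e.symm
    have : (M'.comap (Polynomial.C : _ →+* Polynomial (MvPolynomial (Fin s) k))).IsMaximal :=
      Polynomial.isMaximal_comap_C_of_isJacobsonRing M'
    have : M'.LiesOver (M'.comap (Polynomial.C : _ →+* Polynomial (MvPolynomial (Fin s) k))) :=
      ⟨rfl⟩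
    rw [Polynomial.height_eq_height_add_one
      (M'.comap (Polynomial.C : _ →+* Polynomial (MvPolynomial (Fin s) k))) M', ih]
    simp

/-- Incomparability: contraction of primes is strictly monotone, even without injectivity. -/
theorem ringKrullDim_le_of_isIntegral {A B : Type*} [CommRing A] [CommRing B] [Algebra A B]
    [Algebra.IsIntegral A B] : ringKrullDim B ≤ ringKrullDim A := by
  refine Order.krullDim_le_of_strictMono (PrimeSpectrum.comap (algebraMap A B)) ?_
  intro p q hpq
  exact Ideal.IsIntegral.comap_lt_comap (R := A) (A := B) hpq

theorem Ideal.height_under_le_of_hasGoingDown {A B : Type*} [CommRing A] [CommRing B] [Algebra A B]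
    [Algebra.HasGoingDown A B] (Q : Ideal B) [Q.IsPrime] : (Q.under A).height ≤ Q.height := by
  rw [PrimeSpectrum.height_eq_orderHeight ⟨Q, ‹_›⟩,
    PrimeSpectrum.height_eq_orderHeight ⟨Q.under A, inferInstance⟩]
  refine Order.height_le fun l hl => ?_
  have : Q.LiesOver l.last.asIdeal := ⟨by rw [hl]⟩
  obtain ⟨L, hL, hlast, -⟩ := Ideal.exists_ltSeries_of_hasGoingDown l Q
  rw [← hL]
  exact Order.length_le_height hlast.le

/-- If `b` becomes a unit, then an extension all of whose elements have a `b`-multiple in the base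
does not change heights of primes avoiding `b`. -/
theorem Ideal.height_under_of_forall_pow_mul_mem {A B : Type*} [CommRing A] [CommRing B]
    [Algebra A B] [FaithfulSMul A B] (b : A)
    (hb : ∀ x : B, ∃ (N : ℕ) (a : A), algebraMap A B b ^ N * x = algebraMap A B a)
    (Q : Ideal B) [Q.IsPrime] (hQ : algebraMap A B b ∉ Q) : (Q.under A).height = Q.height := by
  let β := algebraMap A B b
  let C := Localization.Away β
  have hinj := FaithfulSMul.algebraMap_injective A B
  -- Inverting `b` in `A` or in `B` gives the same ring, so both heights can be read there.
  have : IsLocalization (Submonoid.powers b) C := by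
    refine ⟨?_⟩
    constructor
    · rintro ⟨_, N, rfl⟩
      rw [IsScalarTower.algebraMap_apply A B C, map_pow]
      exact IsLocalization.map_units C (⟨_, N, rfl⟩ : Submonoid.powers β)
    · intro z
      obtain ⟨⟨x, ⟨_, M, rfl⟩⟩, hx⟩ := IsLocalization.surj (Submonoid.powers β) z
      obtain ⟨N, a, ha⟩ := hb x
      refine ⟨⟨a, ⟨_, N + M, rfl⟩⟩, ?_⟩
      simp only at hx ⊢
      rw [IsScalarTower.algebraMap_apply A B C, IsScalarTower.algebraMap_apply A B C a, ← ha,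
        map_pow, map_mul, ← hx, pow_add, map_mul]
      ring
    · intro x y hxy
      rw [IsScalarTower.algebraMap_apply A B C, IsScalarTower.algebraMap_apply A B C] at hxy
      obtain ⟨⟨_, N, rfl⟩, hc⟩ := (IsLocalization.eq_iff_exists (Submonoid.powers β) C).mp hxy
      refine ⟨⟨_, N, rfl⟩, hinj ?_⟩
      simpa [β] using hc
  have hdis : Disjoint (Submonoid.powers β : Set B) (Q : Set B) := by
    rw [Set.disjoint_left]
    rintro _ ⟨N, rfl⟩ h
    exact hQ (Ideal.IsPrime.mem_of_pow_mem ‹_› N h)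
  have h1 : (Q.map (algebraMap B C)).under B = Q :=
    IsLocalization.under_map_of_isPrime_disjoint (Submonoid.powers β) C ‹_› hdis
  have h2 : (Q.map (algebraMap B C)).under A = Q.under A := by
    rw [← Ideal.under_under (A := A) (B := B), h1]
  rw [← h2, IsLocalization.height_under (Submonoid.powers b),
    ← IsLocalization.height_under (Submonoid.powers β), h1]

end CommutativeAlgebra
end

noncomputable section

/-! ### Relative Noether normalization. -/

section NoetherNormalization

attribute [local instance] MvPolynomial.algebraMvPolynomial

theorem exists_ne_zero_smul_eq_algebraMap_of_mem_adjoin {P T K F : Type*} [CommRing P] [IsDomain P]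
    [CommRing T] [Algebra P T] [Field K] [Algebra P K] [IsFractionRing P K] [Field F] [Algebra T F]
    [Algebra P F] [Algebra K F] [IsScalarTower P T F] [IsScalarTower P K F] (t : Set T) {x : F}
    (hx : x ∈ Algebra.adjoin K (algebraMap T F '' t)) :
    ∃ p : P, p ≠ 0 ∧ ∃ y : T, algebraMap P F p * x = algebraMap T F y := by
  induction hx using Algebra.adjoin_induction with
  | mem x hx =>
    obtain ⟨y, -, rfl⟩ := hx
    exact ⟨1, one_ne_zero, y, by simp⟩
  | algebraMap c =>
    obtain ⟨⟨a, p⟩, h⟩ := IsLocalization.surj (nonZeroDivisors P) c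
    refine ⟨p, nonZeroDivisors.coe_ne_zero p, algebraMap P T a, ?_⟩
    rw [← IsScalarTower.algebraMap_apply, IsScalarTower.algebraMap_apply P K F,
      IsScalarTower.algebraMap_apply P K F a, ← h, map_mul, mul_comm]
  | add x y _ _ hx hy =>
    obtain ⟨p, hp, a, ha⟩ := hx
    obtain ⟨q, hq, b, hb⟩ := hy
    refine ⟨p * q, mul_ne_zero hp hq, algebraMap P T q * a + algebraMap P T p * b, ?_⟩
    simp only [map_mul, map_add, ← ha, ← hb, ← IsScalarTower.algebraMap_apply]
    ring
  | mul x y _ _ hx hy =>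
    obtain ⟨p, hp, a, ha⟩ := hx
    obtain ⟨q, hq, b, hb⟩ := hy
    refine ⟨p * q, mul_ne_zero hp hq, a * b, ?_⟩
    simp only [map_mul, ← ha, ← hb]
    ring

/-- Noether normalization of a finitely generated domain over a domain, after inverting one
element of the base. -/
theorem exists_algebraicIndependent_isIntegralElem (P T : Type*) [CommRing P] [IsDomain P]
    [CommRing T] [IsDomain T] [Algebra P T] [FaithfulSMul P T] [Algebra.FiniteType P T] :
    ∃ (m : ℕ) (z : Fin m → T) (b : P) (t : Finset T), AlgebraicIndependent P z ∧ b ≠ 0 ∧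
      Algebra.adjoin P (t : Set T) = ⊤ ∧ ∀ x ∈ t,
        (aeval z : MvPolynomial (Fin m) P →ₐ[P] T).toRingHom.IsIntegralElem
          (algebraMap P T b * x) := by
  classical
  obtain ⟨t, ht⟩ := ‹Algebra.FiniteType P T›.out
  let K := FractionRing P
  let F := FractionRing T
  let : Algebra K F := FractionRing.liftAlgebra P F
  have : IsScalarTower P K F := FractionRing.isScalarTower_liftAlgebra P F
  -- Ordinary Noether normalization is applied to the generic fibre `U`, over the fraction field `K`
  -- of `P`.
  let U : Subalgebra K F := Algebra.adjoin K (algebraMap T F '' t)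
  have : Algebra.FiniteType K U :=
    Subalgebra.fg_iff_finiteType _ |>.mp
      ⟨t.image (algebraMap T F), by simp [U]⟩
  obtain ⟨m, g, ginj, gint⟩ := exists_integral_inj_algHom_of_fg K U
  have hden (i : Fin m) := exists_ne_zero_smul_eq_algebraMap_of_mem_adjoin (P := P) (t : Set T)
    (g (X i)).2
  choose p hp z hz using hden
  have hpK (i : Fin m) : algebraMap P K (p i) ≠ 0 := by simpa [K] using hp i
  -- Rescaling the variables by the denominators `p i` moves the normalizing elements into `T`. It
  -- is an automorphism over `K`, so injectivity and integrality survive.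
  let σ : MvPolynomial (Fin m) K →ₐ[K] MvPolynomial (Fin m) K :=
    aeval fun i => C (algebraMap P K (p i)) * X i
  let σ' : MvPolynomial (Fin m) K →ₐ[K] MvPolynomial (Fin m) K :=
    aeval fun i => C (algebraMap P K (p i))⁻¹ * X i
  have hσ : σ'.comp σ = AlgHom.id K _ := by
    ext1 i
    simp only [σ, σ', AlgHom.comp_apply, aeval_X, map_mul, algHom_C, algebraMap_eq,
      AlgHom.id_apply, ← mul_assoc, ← C_mul, mul_inv_cancel₀ (hpK i), C_1, one_mul]
  have hσ' : σ.comp σ' = AlgHom.id K _ := by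
    ext1 i
    simp only [σ, σ', AlgHom.comp_apply, aeval_X, map_mul, algHom_C, algebraMap_eq,
      AlgHom.id_apply, ← mul_assoc, ← C_mul, inv_mul_cancel₀ (hpK i), C_1, one_mul]
  let g' : MvPolynomial (Fin m) K →ₐ[K] F := aeval fun i => algebraMap T F (z i)
  have hg' : g' = (U.val.comp g).comp σ := by
    ext1 i
    simp only [g', σ, AlgHom.comp_apply, aeval_X, map_mul, algHom_C, ← hz i]
    rw [IsScalarTower.algebraMap_apply P K F]
    rfl
  have hg'' : U.val.comp g = g'.comp σ' := by
    rw [hg', AlgHom.comp_assoc, hσ', AlgHom.comp_id]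
  have hind : AlgebraicIndependent K fun i => algebraMap T F (z i) := by
    change Function.Injective g'
    rw [hg']
    exact (Subtype.val_injective.comp ginj).comp
      (Function.LeftInverse.injective (g := σ') fun x => DFunLike.congr_fun hσ x)
  have hindP : AlgebraicIndependent P z := by
    have h1 : AlgebraicIndependent P fun i => algebraMap T F (z i) :=
      hind.restrictScalars (IsFractionRing.injective P K)
    exact AlgebraicIndependent.of_comp (IsScalarTower.toAlgHom P T F) h1
  have hint (x : T) (hx : x ∈ t) : ∃ b : P, b ≠ 0 ∧
      (aeval z : MvPolynomial (Fin m) P →ₐ[P] T).toRingHom.IsIntegralElem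
        (algebraMap P T b * x) := by
    let : Algebra (MvPolynomial (Fin m) K) F := g'.toAlgebra
    let : Algebra (MvPolynomial (Fin m) P) F :=
      (aeval fun i => algebraMap T F (z i) : MvPolynomial (Fin m) P →ₐ[P] F).toAlgebra
    have : IsScalarTower (MvPolynomial (Fin m) P) (MvPolynomial (Fin m) K) F :=
      IsScalarTower.of_algebraMap_eq fun q => by
        change aeval _ q = g' (map (algebraMap P K) q)
        simp [g', aeval_map_algebraMap]
    have h1 : IsIntegral (MvPolynomial (Fin m) K) (algebraMap T F x) := by
      obtain ⟨q, hq, hqx⟩ := gint ⟨algebraMap T F x, Algebra.subset_adjoin ⟨x, hx, rfl⟩⟩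
      refine ⟨q.map σ'.toRingHom, hq.map _, ?_⟩
      rw [Polynomial.eval₂_map]
      have := congrArg U.val hqx
      rw [map_zero] at this
      rw [← this, ← AlgHom.coe_toRingHom, Polynomial.hom_eval₂]
      congr 1
      exact RingHom.ext fun y => (DFunLike.congr_fun hg'' y).symm
    -- `K[X]` is the localization of `P[X]` at the nonzero constants of `P`, so one such constant
    -- clears the denominators of the integral equation.
    obtain ⟨⟨_, ⟨b, hb, rfl⟩⟩, q, hq, hqx⟩ := h1.exists_multiple_integral_of_isLocalization
      ((nonZeroDivisors P).map (C (σ := Fin m)))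
    refine ⟨b, nonZeroDivisors.ne_zero hb, q, hq, IsFractionRing.injective T F ?_⟩
    rw [map_zero, Polynomial.hom_eval₂, ← hqx]
    congr 1
    · exact RingHom.ext fun y => (aeval_algebraMap_apply F z y).symm
    · rw [Submonoid.smul_def, Algebra.smul_def, map_mul, ← IsScalarTower.algebraMap_apply]
      simp [RingHom.algebraMap_toAlgebra]
  choose! b hb hbint using hint
  refine ⟨m, z, ∏ x ∈ t, b x, t, hindP, Finset.prod_ne_zero_iff.mpr hb, ht, fun x hx => ?_⟩
  rw [← Finset.prod_erase_mul _ _ hx, map_mul, mul_assoc]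
  refine RingHom.IsIntegralElem.mul _ ?_ (hbint x hx)
  have := RingHom.isIntegralElem_map (aeval z : MvPolynomial (Fin m) P →ₐ[P] T).toRingHom
    (x := C (∏ x ∈ t.erase x, b x))
  simpa using this

end NoetherNormalization
end

noncomputable section

/-! ### Codimension of general fibres. -/

section GenericFibre

theorem exists_pow_mul_mem_of_adjoin_eq_top {P T : Type*} [CommRing P] [CommRing T] [Algebra P T]
    (b : T) (t : Set T) (ht : Algebra.adjoin P t = ⊤) (C : Subring T)
    (hP : ∀ a, algebraMap P T a ∈ C) (hb : b ∈ C) (hC : ∀ x ∈ t, b * x ∈ C) (x : T) :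
    ∃ N : ℕ, b ^ N * x ∈ C := by
  have hx : x ∈ Algebra.adjoin P t := ht ▸ Algebra.mem_top
  induction hx using Algebra.adjoin_induction with
  | mem x hx => exact ⟨1, by simpa using hC x hx⟩
  | algebraMap a => exact ⟨0, by simpa using hP a⟩
  | add x y _ _ hx hy =>
    obtain ⟨N, hN⟩ := hx
    obtain ⟨M, hM⟩ := hy
    refine ⟨N + M, ?_⟩
    rw [show b ^ (N + M) * (x + y) = b ^ M * (b ^ N * x) + b ^ N * (b ^ M * y) by ring]
    exact C.add_mem (C.mul_mem (C.pow_mem hb M) hN) (C.mul_mem (C.pow_mem hb N) hM)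
  | mul x y _ _ hx hy =>
    obtain ⟨N, hN⟩ := hx
    obtain ⟨M, hM⟩ := hy
    refine ⟨N + M, ?_⟩
    rw [show b ^ (N + M) * (x * y) = (b ^ N * x) * (b ^ M * y) by ring]
    exact C.mul_mem hN hM

/-- Going-down holds for `P → P[z]` and for `P[z] → C`, with `C` the integral closure of `P[z]` in
`T`. The second uses normality of `P[z]`, which comes from unique factorization in `P`. Away from
`b` the rings `C` and `T` agree. -/
theorem exists_ne_zero_forall_height_under_le (P T : Type*) [CommRing P] [IsDomain P]
    [UniqueFactorizationMonoid P] [CommRing T] [IsDomain T] [Algebra P T] [FaithfulSMul P T]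
    [Algebra.FiniteType P T] :
    ∃ b : P, b ≠ 0 ∧ ∀ Q : Ideal T, Q.IsPrime → algebraMap P T b ∉ Q →
      (Q.under P).height ≤ Q.height := by
  obtain ⟨m, z, b, t, hz, hb, ht, hint⟩ := exists_algebraicIndependent_isIntegralElem P T
  refine ⟨b, hb, fun Q hQ hbQ => ?_⟩
  let R := MvPolynomial (Fin m) P
  let : Algebra R T := (aeval z : MvPolynomial (Fin m) P →ₐ[P] T).toAlgebra
  have : IsScalarTower P R T := IsScalarTower.of_algebraMap_eq fun a => by
    simp [RingHom.algebraMap_toAlgebra, R]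
  have : FaithfulSMul R T := (faithfulSMul_iff_algebraMap_injective R T).mpr hz
  let C := integralClosure R T
  have : FaithfulSMul R C := (faithfulSMul_iff_algebraMap_injective R C).mpr
    fun a c h => hz (congrArg Subtype.val h)
  have : Algebra.HasGoingDown R C := inferInstance
  have : Algebra.HasGoingDown P R := inferInstance
  have : Algebra.HasGoingDown P C := Algebra.HasGoingDown.trans P R C
  have hPC (a : P) : algebraMap P T a ∈ C := by
    rw [IsScalarTower.algebraMap_apply P R T]
    exact C.algebraMap_mem _
  have key := Ideal.height_under_of_forall_pow_mul_mem (A := C) (B := T) ⟨_, hPC b⟩ (fun x => by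
    obtain ⟨N, hN⟩ := exists_pow_mul_mem_of_adjoin_eq_top (algebraMap P T b) (t : Set T) ht
      C.toSubring hPC (hPC b) hint x
    exact ⟨N, ⟨_, hN⟩, rfl⟩) Q hbQ
  rw [← key, ← Ideal.under_under (A := P) (B := C)]
  exact Ideal.height_under_le_of_hasGoingDown _

/-- The lower bound for the codimension of the general fibres of a dominant morphism of affine
varieties. -/
theorem exists_ne_zero_forall_ringKrullDim_le_height (k B T : Type*) [Field k] [CommRing B]
    [IsDomain B] [CommRing T] [IsDomain T] [Algebra k B] [Algebra k T] [Algebra B T]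
    [IsScalarTower k B T] [FaithfulSMul B T] [Algebra.FiniteType k B] [Algebra.FiniteType k T] :
    ∃ b : B, b ≠ 0 ∧ ∀ Q : Ideal T, Q.IsPrime → (Q.under B).IsMaximal → algebraMap B T b ∉ Q →
      ringKrullDim B ≤ Q.height := by
  -- Replacing `B` by a polynomial ring `P` over which it is integral supplies unique factorization.
  -- Maximal ideals of `B` contract to maximal ideals of `P`, whose height is `s ≥ dim B`.
  obtain ⟨s, g, ginj, gint⟩ := exists_integral_inj_algHom_of_fg k B
  let P := MvPolynomial (Fin s) k
  let : Algebra P B := g.toAlgebra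
  let : Algebra P T := ((algebraMap B T).comp g.toRingHom).toAlgebra
  have : IsScalarTower P B T := IsScalarTower.of_algebraMap_eq fun a => rfl
  have : IsScalarTower k P T := IsScalarTower.of_algebraMap_eq fun a => by
    change _ = algebraMap B T (g (algebraMap k P a))
    rw [g.commutes, ← IsScalarTower.algebraMap_apply]
  have : FaithfulSMul P B := (faithfulSMul_iff_algebraMap_injective P B).mpr ginj
  have : FaithfulSMul P T := (faithfulSMul_iff_algebraMap_injective P T).mpr
    ((FaithfulSMul.algebraMap_injective B T).comp ginj)
  have : Algebra.IsIntegral P B := ⟨gint⟩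
  have : Algebra.FiniteType P T := .of_restrictScalars_finiteType k P T
  obtain ⟨b, hb, h⟩ := exists_ne_zero_forall_height_under_le P T
  refine ⟨algebraMap P B b, by simpa using hb, fun Q hQ hmax hbQ => ?_⟩
  have h1 := h Q hQ (by rwa [IsScalarTower.algebraMap_apply P B T])
  have : (Q.under P).IsMaximal := by
    rw [← Ideal.under_under (A := P) (B := B)]
    exact Ideal.isMaximal_comap_of_isIntegral_of_isMaximal _
  rw [MvPolynomial.height_of_isMaximal] at h1
  refine (ringKrullDim_le_of_isIntegral (A := P)).trans ?_
  rw [MvPolynomial.ringKrullDim_of_isNoetherianRing, ringKrullDim_eq_zero_of_field]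
  simpa using WithBot.coe_le_coe.mpr h1

end GenericFibre

/-! ### Consequences of a fibre that is a single reduced point. -/

section ReducedFibre

/-- The fibre through `M` has dimension zero, so `N = ht M ≤ ht (M ∩ A) ≤ dim A ≤ s`. The `s`
independent elements normalizing `A` therefore already form a transcendence basis of the polynomial
ring. -/
theorem MvPolynomial.isAlgebraic_of_isMaximal_le_map {k A : Type*} [Field k] {N : ℕ} [CommRing A]
    [IsDomain A] [Algebra k A] [Algebra A (MvPolynomial (Fin N) k)]
    [IsScalarTower k A (MvPolynomial (Fin N) k)] [FaithfulSMul A (MvPolynomial (Fin N) k)]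
    [Algebra.FiniteType k A] (M : Ideal (MvPolynomial (Fin N) k)) [M.IsMaximal]
    (hM : M ≤ (M.under A).map (algebraMap A (MvPolynomial (Fin N) k))) :
    Algebra.IsAlgebraic A (MvPolynomial (Fin N) k) := by
  let T := MvPolynomial (Fin N) k
  have : IsNoetherianRing A := Algebra.FiniteType.isNoetherianRing k A
  obtain ⟨s, g, ginj, gint⟩ := exists_integral_inj_algHom_of_fg k A
  let : Algebra (MvPolynomial (Fin s) k) A := g.toAlgebra
  have : Algebra.IsIntegral (MvPolynomial (Fin s) k) A := ⟨gint⟩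
  have hdim : ringKrullDim A ≤ s := by
    refine (ringKrullDim_le_of_isIntegral (A := MvPolynomial (Fin s) k)).trans ?_
    rw [MvPolynomial.ringKrullDim_of_isNoetherianRing, ringKrullDim_eq_zero_of_field]
    simp
  have hle : N ≤ s := by
    have h1 := Ideal.height_le_height_add_of_liesOver (M.under A) M
    rw [MvPolynomial.height_of_isMaximal] at h1
    have h2 : (M.map (Ideal.Quotient.mk <| (M.under A).map (algebraMap A T))) = ⊥ := by
      rw [eq_bot_iff, Ideal.map_le_iff_le_comap]
      intro x hx
      simpa [Ideal.Quotient.eq_zero_iff_mem] using hM hx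
    have hne : (M.under A).map (algebraMap A T) ≠ ⊤ := fun h =>
      Ideal.IsPrime.ne_top ‹M.IsMaximal›.isPrime (top_le_iff.mp (h ▸ Ideal.map_comap_le))
    have : Nontrivial (T ⧸ (M.under A).map (algebraMap A T)) :=
      Ideal.Quotient.nontrivial_iff.mpr hne
    rw [h2, Ideal.height_bot, add_zero] at h1
    have h3 : ((N : ℕ∞) : WithBot ℕ∞) ≤ s :=
      (WithBot.coe_le_coe.mpr h1).trans (Ideal.height_le_ringKrullDim_of_isPrime.trans hdim)
    exact_mod_cast h3
  let ι : A →ₐ[k] T := IsScalarTower.toAlgHom k A T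
  let z : Fin s → T := fun i => ι (g (X i))
  have hz : AlgebraicIndependent k z := by
    have : (aeval z : MvPolynomial (Fin s) k →ₐ[k] T) = ι.comp g := by
      ext1 i
      simp [z]
    rw [algebraicIndependent_iff_injective_aeval, this]
    exact (FaithfulSMul.algebraMap_injective A T).comp ginj
  have hb : IsTranscendenceBasis k z := by
    refine hz.isTranscendenceBasis_of_lift_trdeg_le_of_finite ?_
    rw [MvPolynomial.trdeg_of_isDomain]
    simpa using hle
  have halg := hb.isAlgebraic
  refine ⟨fun x => ?_⟩
  obtain ⟨p, hp, hpx⟩ := halg.isAlgebraic x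
  let e : Algebra.adjoin k (Set.range z) →ₐ[k] ι.range := Subalgebra.inclusion (by
      rw [Algebra.adjoin_le_iff]
      rintro _ ⟨i, rfl⟩
      exact ⟨_, rfl⟩)
  let e' : A ≃ₐ[k] ι.range := AlgEquiv.ofInjective ι (FaithfulSMul.algebraMap_injective A T)
  let ρ : Algebra.adjoin k (Set.range z) →ₐ[k] A := e'.symm.toAlgHom.comp e
  have hρ (y) : algebraMap A T (ρ y) = y :=
    congrArg Subtype.val (e'.apply_symm_apply (e y))
  have hρi : Function.Injective ρ := fun a b hab => Subtype.ext (by rw [← hρ a, ← hρ b, hab])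
  refine ⟨p.map ρ.toRingHom, (Polynomial.map_ne_zero_iff hρi).mpr hp, ?_⟩
  rw [Polynomial.aeval_def, Polynomial.eval₂_map, ← hpx, Polynomial.aeval_def]
  congr 1
  exact RingHom.ext hρ

/-- Nakayama's lemma for the finite `A`-module `C = A[b x : x ∈ t]`, at the rational point `q = ker
π ∩ A`. The fibre hypothesis gives `C = A + q C`, so some `r ≡ 1` modulo `q` satisfies `r C ⊆ A`,
and `D = r b` works. -/
theorem exists_ne_zero_forall_exists_mul_mem {k A T : Type*} [Field k] [CommRing A] [IsDomain A]
    [CommRing T] [IsDomain T] [Algebra k A] [Algebra k T] [Algebra A T] [IsScalarTower k A T]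
    [Algebra.IsAlgebraic A T] (t : Finset T) (ht : Algebra.adjoin A (t : Set T) = ⊤) :
    ∃ b : A, b ≠ 0 ∧ ∀ π : T →ₐ[k] k, π (algebraMap A T b) ≠ 0 →
      RingHom.ker π ≤ ((RingHom.ker π).under A).map (algebraMap A T) →
      ∃ D : A, π (algebraMap A T D) ≠ 0 ∧ ∀ x ∈ t, ∃ c : A,
        algebraMap A T D * x = algebraMap A T c := by
  classical
  obtain ⟨b, hb, hint⟩ := Algebra.IsAlgebraic.exists_integral_multiples A t
  refine ⟨b, hb, fun π hπ hker => ?_⟩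
  let τ : Finset T := t.image fun x => b • x
  let C := Algebra.adjoin A (τ : Set T)
  let q := (RingHom.ker π).under A
  let N := Subalgebra.toSubmodule C
  have hq (a : A) : a ∈ q ↔ π (algebraMap A T a) = 0 := Iff.rfl
  have hfg : N.FG := fg_adjoin_of_finite τ.finite_toSet (by
    intro x hx
    obtain ⟨y, hy, rfl⟩ := Finset.mem_image.mp (Finset.mem_coe.mp hx)
    exact hint y hy)
  have hsc (c : k) : algebraMap k T c = algebraMap A T (algebraMap k A c) :=
    IsScalarTower.algebraMap_apply k A T c
  have hsmul {a : A} {y : T} (ha : a ∈ q) (hy : y ∈ C) : algebraMap A T a * y ∈ q • N := by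
    rw [← Algebra.smul_def]
    exact Submodule.smul_mem_smul ha hy
  have hmulN {x y : T} (hx : x ∈ q • N) (hy : y ∈ C) : x * y ∈ q • N := by
    induction hx using Submodule.smul_induction_on' with
    | smul a ha n hn =>
      rw [smul_mul_assoc]
      exact Submodule.smul_mem_smul ha (C.mul_mem hn hy)
    | add x _ y' _ h1 h2 => rw [add_mul]; exact Submodule.add_mem _ h1 h2
  have hsub (a : A) : a - algebraMap k A (π (algebraMap A T a)) ∈ q := by
    rw [hq, map_sub, map_sub, ← hsc, AlgHom.commutes]
    simp
  have hbC : algebraMap A T b ∈ C := C.algebraMap_mem b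
  -- The fibre hypothesis concerns `q T`; powers of `b` bring its elements into `q C`.
  have hpow (x : T) (hx : x ∈ Submodule.span T (algebraMap A T '' q)) :
      ∃ M : ℕ, algebraMap A T b ^ M * x ∈ q • N := by
    induction hx using Submodule.span_induction with
    | mem x hx =>
      obtain ⟨a, ha, rfl⟩ := hx
      exact ⟨0, by simpa using hsmul ha C.one_mem⟩
    | zero => exact ⟨0, by simp⟩
    | add x y _ _ h1 h2 =>
      obtain ⟨M1, h1⟩ := h1
      obtain ⟨M2, h2⟩ := h2
      refine ⟨M1 + M2, ?_⟩
      rw [show algebraMap A T b ^ (M1 + M2) * (x + y) = (algebraMap A T b ^ M1 * x) *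
        algebraMap A T b ^ M2 + (algebraMap A T b ^ M2 * y) * algebraMap A T b ^ M1 by ring]
      exact Submodule.add_mem _ (hmulN h1 (C.pow_mem hbC _)) (hmulN h2 (C.pow_mem hbC _))
    | smul c x _ h1 =>
      obtain ⟨M1, h1⟩ := h1
      obtain ⟨M2, h2⟩ := exists_pow_mul_mem_of_adjoin_eq_top (algebraMap A T b) (t : Set T) ht
        C.toSubring C.algebraMap_mem hbC (fun x hx => Algebra.subset_adjoin
          (Finset.mem_coe.mpr (Finset.mem_image.mpr ⟨x, hx, Algebra.smul_def b x⟩))) c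
      refine ⟨M1 + M2, ?_⟩
      rw [smul_eq_mul, show algebraMap A T b ^ (M1 + M2) * (c * x) =
        (algebraMap A T b ^ M1 * x) * (algebraMap A T b ^ M2 * c) by ring]
      exact hmulN h1 h2
  set β := π (algebraMap A T b) with hβ
  -- Those powers can be cancelled, since `b` acts on `C / q C` as the nonzero scalar `β`.
  have hunit (y : T) (hy : y ∈ C) (M : ℕ) (h : algebraMap A T b ^ M * y ∈ q • N) : y ∈ q • N := by
    have h1 := hsmul (hsub (b ^ M)) hy
    rw [map_sub, sub_mul, map_pow] at h1
    have h2 := Submodule.sub_mem _ h h1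
    rw [sub_sub_cancel, map_pow, ← hβ, ← Algebra.smul_def] at h2
    have h3 := Submodule.smul_mem _ (algebraMap k A (β ^ M)⁻¹) h2
    rwa [smul_smul, ← map_mul, inv_mul_cancel₀ (pow_ne_zero M hπ), map_one, one_smul] at h3
  have hmain (y : T) (hy : y ∈ C) : y - algebraMap k T (π y) ∈ q • N := by
    induction hy using Algebra.adjoin_induction with
    | mem y hy =>
      obtain ⟨x, hx, rfl⟩ := Finset.mem_image.mp (Finset.mem_coe.mp hy)
      have hxC : b • x ∈ C := Algebra.subset_adjoin hy
      have h1 : algebraMap A T b * (x - algebraMap k T (π x)) ∈ q • N := by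
        obtain ⟨M, hM⟩ := hpow (x - algebraMap k T (π x)) (hker (by simp [RingHom.mem_ker]))
        refine hunit _ ?_ M ?_
        · rw [mul_sub, ← Algebra.smul_def, hsc, ← map_mul]
          exact C.sub_mem hxC (C.algebraMap_mem _)
        · rw [mul_left_comm, mul_comm]
          exact hmulN hM hbC
      have h2 := hsmul (hsub b) (C.algebraMap_mem (algebraMap k A (π x)))
      convert Submodule.add_mem _ h1 h2 using 1
      rw [Algebra.smul_def, map_mul, map_mul, map_sub, ← hsc, ← hsc]
      ring
    | algebraMap a =>
      have := hsmul (hsub a) C.one_mem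
      rwa [mul_one, map_sub, ← hsc] at this
    | add x y _ _ h1 h2 =>
      convert Submodule.add_mem _ h1 h2 using 1
      rw [map_add, map_add]
      ring
    | mul x y hx hy h1 h2 =>
      convert Submodule.add_mem _ (hmulN h1 hy)
        (hmulN h2 (hsc (π x) ▸ C.algebraMap_mem _ : algebraMap k T (π x) ∈ C)) using 1
      rw [map_mul, map_mul]
      ring
  obtain ⟨r, hr, hrN⟩ := Submodule.exists_sub_one_mem_and_smul_le_of_fg_of_le_sup
    (I := q) (N := (1 : Submodule A T)) hfg le_rfl (by
      intro y hy
      rw [← sub_add_cancel y (algebraMap k T (π y)), add_comm]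
      refine Submodule.add_mem_sup ?_ (hmain y hy)
      rw [hsc]
      exact Submodule.mem_one.mpr ⟨_, rfl⟩)
  refine ⟨r * b, ?_, fun x hx => ?_⟩
  · have hr' : π (algebraMap A T r) = 1 := by
      rw [hq, map_sub, map_sub, map_one, map_one, sub_eq_zero] at hr
      exact hr
    rw [map_mul, map_mul, hr', one_mul]
    exact hπ
  · have h1 : r • (b • x) ∈ (1 : Submodule A T) := hrN (Submodule.smul_mem_pointwise_smul _ r N
      (Algebra.subset_adjoin (Finset.mem_coe.mpr (Finset.mem_image_of_mem _ hx))))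
    obtain ⟨c, hc⟩ := Submodule.mem_one.mp h1
    exact ⟨c, by rw [hc, map_mul, Algebra.smul_def, Algebra.smul_def, mul_assoc]⟩

end ReducedFibre
end

noncomputable section

/-! ### Ideals of rational points, linear ideals and homogenization. -/

section Forms

theorem MvPolynomial.IsHomogeneous.aeval_mul_left {R A σ : Type*} [CommSemiring R] [CommSemiring A]
    [Algebra R A] {G : MvPolynomial σ R} {e : ℕ} (hG : G.IsHomogeneous e) (c : A) (v : σ → A) :
    MvPolynomial.aeval (fun i => c * v i) G = c ^ e * MvPolynomial.aeval v G := by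
  simp only [aeval_def, eval₂_eq, Finset.mul_sum]
  refine Finset.sum_congr rfl fun m hm => ?_
  simp only [mul_pow, Finset.prod_mul_distrib, Finset.prod_pow_eq_pow_sum]
  rw [show ∑ i ∈ m.support, m i = e from (hG.degree_eq_sum_deg_support hm).symm]
  ring

namespace RowIdeals

variable {k : Type*} [Field k] {n r : ℕ}

/-- The homogeneous ideal of the point of `P^n` with homogeneous coordinates `p`. -/
def pointIdeal (p : Fin (n + 1) → k) : Ideal (MvPolynomial (Fin (n + 1)) k) :=
  Ideal.span (Set.range fun ij : Fin (n + 1) × Fin (n + 1) =>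
    C (p ij.1) * X ij.2 - C (p ij.2) * X ij.1)

theorem gen_mem_pointIdeal (p : Fin (n + 1) → k) (i j : Fin (n + 1)) :
    C (p i) * X j - C (p j) * X i ∈ pointIdeal p :=
  Ideal.subset_span ⟨(i, j), rfl⟩

theorem isLinearIdeal_pointIdeal (p : Fin (n + 1) → k) : IsLinearIdeal (pointIdeal p) :=
  ⟨_, by
    rintro _ ⟨ij, rfl⟩
    exact (isHomogeneous_C_mul_X _ _).sub (isHomogeneous_C_mul_X _ _), rfl⟩

theorem eval_eq_zero_of_mem_pointIdeal {p : Fin (n + 1) → k} {G : MvPolynomial (Fin (n + 1)) k}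
    (hG : G ∈ pointIdeal p) : eval p G = 0 := by
  have : pointIdeal p ≤ RingHom.ker (eval p) := by
    refine Ideal.span_le.mpr ?_
    rintro _ ⟨ij, rfl⟩
    simp [RingHom.mem_ker, mul_comm]
  exact this hG

/-- Choose `a` with `p a ≠ 0`. Modulo the point ideal `p_a x_j = p_j x_a`, hence `p_a^e G = x_a^e
G(p)`. -/
theorem mem_pointIdeal_of_isHomogeneous {p : Fin (n + 1) → k} (hp : p ≠ 0)
    {G : MvPolynomial (Fin (n + 1)) k} {e : ℕ} (hG : G.IsHomogeneous e) (h0 : eval p G = 0) :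
    G ∈ pointIdeal p := by
  obtain ⟨a, ha⟩ := Function.ne_iff.mp hp
  let φ := Ideal.Quotient.mkₐ k (pointIdeal p)
  have hφ (H : MvPolynomial (Fin (n + 1)) k) : φ H = aeval (fun j => φ (X j)) H := by
    conv_lhs => rw [aeval_unique φ]
    rfl
  have h1 (j : Fin (n + 1)) : φ (C (p a)) * φ (X j) = φ (X a) * φ (C (p j)) := by
    rw [← map_mul, ← map_mul, mul_comm (X a)]
    exact Ideal.Quotient.eq.mpr (gen_mem_pointIdeal p a j)
  have h2 := hG.aeval_mul_left (φ (C (p a))) (fun j => φ (X j))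
  simp_rw [h1] at h2
  have h3 : aeval (fun j => φ (C (p j))) G = φ (C (eval p G)) := by
    rw [show (fun j => φ (C (p j))) = fun j => algebraMap k _ (p j) from
      funext fun j => φ.commutes (p j)]
    exact (aeval_algebraMap_apply _ p G).trans (φ.commutes _).symm
  rw [hG.aeval_mul_left, h3, h0, map_zero, map_zero, mul_zero, ← hφ, ← map_pow, ← map_mul,
    ← map_pow] at h2
  have h4 := Ideal.mul_mem_left (pointIdeal p) (C ((p a ^ e)⁻¹))
    (Ideal.Quotient.eq_zero_iff_mem.mp h2.symm)
  rwa [← mul_assoc, ← C_mul, inv_mul_cancel₀ (pow_ne_zero e ha), C_1, one_mul] at h4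

/-- The map restricts polynomials to the line through `p`: the degree `e` part of `G` becomes
`G_e(p) t^e`, so different degrees cannot cancel. Primality follows at once. -/
theorem pointIdeal_eq_ker {p : Fin (n + 1) → k} (hp : p ≠ 0) :
    pointIdeal p = RingHom.ker (aeval fun a => Polynomial.X * Polynomial.C (p a) :
      MvPolynomial (Fin (n + 1)) k →ₐ[k] Polynomial k) := by
  refine le_antisymm (Ideal.span_le.mpr ?_) fun G hG => ?_
  · rintro _ ⟨ij, rfl⟩
    simp only [SetLike.mem_coe, RingHom.mem_ker, map_sub, map_mul, aeval_X, algHom_C,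
      Polynomial.algebraMap_eq]
    ring
  · rw [RingHom.mem_ker] at hG
    have h1 (H : MvPolynomial (Fin (n + 1)) k) (e : ℕ) (hH : H.IsHomogeneous e) :
        aeval (fun a => Polynomial.X * Polynomial.C (p a)) H =
          Polynomial.X ^ e * Polynomial.C (eval p H) := by
      rw [hH.aeval_mul_left]
      congr 1
      exact aeval_algebraMap_apply (Polynomial k) p H
    rw [← sum_homogeneousComponent G]
    refine Ideal.sum_mem _ fun e he => mem_pointIdeal_of_isHomogeneous hp
      (homogeneousComponent_isHomogeneous e G) ?_
    rw [← sum_homogeneousComponent G, map_sum] at hG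
    have h2 := congrArg (fun q => Polynomial.coeff q e) hG
    simp only [Polynomial.finsetSum_coeff, Polynomial.coeff_zero] at h2
    rw [Finset.sum_eq_single_of_mem e he] at h2
    · rw [h1 _ _ (homogeneousComponent_isHomogeneous e G)] at h2
      simpa using h2
    · intro i _ hi
      rw [h1 _ _ (homogeneousComponent_isHomogeneous i G)]
      simp [hi.symm]

theorem isPrime_pointIdeal {p : Fin (n + 1) → k} (hp : p ≠ 0) : (pointIdeal p).IsPrime := by
  rw [pointIdeal_eq_ker hp]
  exact RingHom.ker_isPrime _

theorem pointIdeal_smul {c : k} (hc : c ≠ 0) (p : Fin (n + 1) → k) :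
    pointIdeal (c • p) = pointIdeal p := by
  have h1 (c : k) (p : Fin (n + 1) → k) : pointIdeal (c • p) ≤ pointIdeal p := by
    refine Ideal.span_le.mpr ?_
    rintro _ ⟨ij, rfl⟩
    have := Ideal.mul_mem_left _ (C c) (gen_mem_pointIdeal p ij.1 ij.2)
    rw [mul_sub, ← mul_assoc, ← mul_assoc, ← C_mul, ← C_mul] at this
    exact this
  refine le_antisymm (h1 c p) ?_
  conv_lhs => rw [← inv_smul_smul₀ hc p]
  exact h1 c⁻¹ (c • p)

theorem height_pointIdeal {p : Fin (n + 1) → k} (hp : p 0 ≠ 0) :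
    (pointIdeal p).height = (n : ℕ∞) := by
  let c : Fin n → k := fun a => (p 0)⁻¹ * p a.succ
  -- This linear change of coordinates moves the line through `p` onto the `x_0`-axis. The ideal
  -- becomes the extension of the maximal ideal of the origin in the other `n` variables, which has
  -- height `n`.
  let α : MvPolynomial (Fin (n + 1)) k →ₐ[k] MvPolynomial (Fin (n + 1)) k :=
    aeval (Fin.cons (X 0) fun a => X a.succ + C (c a) * X 0)
  let β : MvPolynomial (Fin (n + 1)) k →ₐ[k] MvPolynomial (Fin (n + 1)) k :=
    aeval (Fin.cons (X 0) fun a => X a.succ - C (c a) * X 0)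
  let ε : MvPolynomial (Fin (n + 1)) k ≃ₐ[k] MvPolynomial (Fin (n + 1)) k :=
    AlgEquiv.ofAlgHom α β
    (by
      ext1 i
      refine Fin.cases ?_ (fun a => ?_) i <;> simp [α, β])
    (by
      ext1 i
      refine Fin.cases ?_ (fun a => ?_) i <;> simp [α, β])
  let M : Ideal (MvPolynomial (Fin n) k) := RingHom.ker (constantCoeff (R := k) (σ := Fin n))
  have hM : M.IsMaximal := RingHom.ker_isMaximal_of_surjective _ fun x => ⟨C x, by simp⟩
  have hh : (M.map (Polynomial.C : _ →+* Polynomial (MvPolynomial (Fin n) k))).height = n := by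
    rw [Polynomial.height_map_C, MvPolynomial.height_of_isMaximal]
  let E : MvPolynomial (Fin (n + 1)) k ≃+* Polynomial (MvPolynomial (Fin n) k) :=
    (ε.trans (finSuccEquiv k n)).toRingEquiv
  rw [← hh, ← E.height_comap, ← Polynomial.ker_mapRingHom]
  congr 1
  have hp' : (p 0)⁻¹ • p ≠ 0 := fun h => by
    have := congrFun h 0
    simp [hp] at this
  rw [← pointIdeal_smul (inv_ne_zero hp) p, pointIdeal_eq_ker hp']
  change _ = RingHom.ker ((Polynomial.mapRingHom constantCoeff).comp E.toRingHom)
  have : (aeval fun a => Polynomial.X * Polynomial.C (((p 0)⁻¹ • p) a) :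
      MvPolynomial (Fin (n + 1)) k →ₐ[k] Polynomial k).toRingHom =
      (Polynomial.mapRingHom constantCoeff).comp E.toRingHom := by
    refine MvPolynomial.ringHom_ext (fun a => ?_) fun i => ?_
    · change aeval _ (C a) = Polynomial.map constantCoeff (finSuccEquiv k n (α (C a)))
      rw [algHom_C, algHom_C, algebraMap_eq, finSuccEquiv_apply, eval₂Hom_C]
      simp
    · change aeval _ (X i) = Polynomial.map constantCoeff (finSuccEquiv k n (α (X i)))
      rw [aeval_X]
      refine Fin.cases ?_ (fun a => ?_) i
      · change Polynomial.X * Polynomial.C ((p 0)⁻¹ * p 0) = _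
        simp only [α, aeval_X, Fin.cons_zero, finSuccEquiv_X_zero, Polynomial.map_X,
          inv_mul_cancel₀ hp, Polynomial.C_1, mul_one]
      · change Polynomial.X * Polynomial.C (c a) = _
        have h1 : α (X a.succ) = X a.succ + C (c a) * X 0 := (aeval_X _ _).trans (Fin.cons_succ _ _ _)
        have h2 : finSuccEquiv k n (C (c a)) = Polynomial.C (C (c a)) := by
          rw [finSuccEquiv_apply, eval₂Hom_C]
          rfl
        rw [h1, map_add, map_mul (finSuccEquiv k n), h2, finSuccEquiv_X_zero, finSuccEquiv_X_succ,
          Polynomial.map_add,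
          Polynomial.map_mul, Polynomial.map_C, Polynomial.map_C, Polynomial.map_X,
          constantCoeff_X, constantCoeff_C, Polynomial.C_0, zero_add, mul_comm]
  rw [← this]
  rfl

/-- A linear ideal of height `n` is the ideal of a rational point. -/
theorem exists_eq_pointIdeal {J : Ideal (MvPolynomial (Fin (n + 1)) k)} (hJ : IsLinearIdeal J)
    (hh : J.height = (n : ℕ∞)) : ∃ p : Fin (n + 1) → k, p ≠ 0 ∧ J = pointIdeal p := by
  classical
  obtain ⟨s, hs, rfl⟩ := hJ
  let Λ : (Fin (n + 1) → k) →ₗ[k] MvPolynomial (Fin (n + 1)) k := Fintype.linearCombination k X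
  have hΛ (v : Fin (n + 1) → k) : Λ v = ∑ a, C (v a) * X a := by
    simp [Λ, Fintype.linearCombination_apply, smul_eq_C_mul]
  have hrange (l : MvPolynomial (Fin (n + 1)) k) (hl : l.IsHomogeneous 1) : ∃ v, Λ v = l := by
    have : l ∈ homogeneousSubmodule (Fin (n + 1)) k 1 := hl
    rw [homogeneousSubmodule_one_eq_span_X, ← Fintype.range_linearCombination] at this
    exact this
  let U : Submodule k (Fin (n + 1) → k) := (Submodule.span k s).comap Λ
  have hspan : Ideal.span s = Ideal.span (Λ '' U) := by
    refine le_antisymm (Ideal.span_mono fun l hl => ?_) (Ideal.span_le.mpr ?_)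
    · obtain ⟨v, rfl⟩ := hrange l (hs l hl)
      exact ⟨v, Submodule.subset_span hl, rfl⟩
    · rintro _ ⟨v, hv, rfl⟩
      exact Submodule.span_le_restrictScalars k (MvPolynomial (Fin (n + 1)) k) s hv
  -- Krull's height theorem: an ideal of height `n` needs at least `n` generators.
  have hge : n ≤ Module.finrank k U := by
    let b := Module.finBasis k U
    let t : Finset (MvPolynomial (Fin (n + 1)) k) := Finset.univ.image fun i => Λ (b i)
    have ht : Ideal.span s = Ideal.span (t : Set (MvPolynomial (Fin (n + 1)) k)) := by
      rw [hspan]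
      refine le_antisymm (Ideal.span_le.mpr ?_) (Ideal.span_mono ?_)
      · rintro _ ⟨v, hv, rfl⟩
        have h1 := b.sum_repr ⟨v, hv⟩
        have h2 := congrArg (fun u : U => Λ u) h1
        simp only [Submodule.coe_sum, Submodule.coe_smul, map_sum, map_smul] at h2
        rw [SetLike.mem_coe, ← h2]
        refine Ideal.sum_mem _ fun i _ => ?_
        rw [smul_eq_C_mul]
        exact Ideal.mul_mem_left _ _ (Ideal.subset_span (by simp [t]))
      · intro l hl
        obtain ⟨i, -, rfl⟩ := Finset.mem_image.mp (Finset.mem_coe.mp hl)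
        exact ⟨b i, (b i).2, rfl⟩
    have hne : Ideal.span s ≠ ⊤ := fun h => by
      rw [h, Ideal.height_top] at hh
      exact ENat.top_ne_natCast n hh
    have h1 := Ideal.height_le_spanFinrank _ hne
    rw [hh, ht] at h1
    have h2 := Submodule.spanFinrank_span_le_ncard_of_finite (R := MvPolynomial (Fin (n + 1)) k)
      (s := (t : Set (MvPolynomial (Fin (n + 1)) k)))
      t.finite_toSet
    rw [Set.ncard_coe_finset] at h2
    have h3 : t.card ≤ Module.finrank k U := by
      simpa using Finset.card_image_le (s := Finset.univ) (f := fun i => Λ (b i))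
    exact (Nat.cast_le.mp h1).trans (h2.trans h3)
  -- All linear forms together generate an ideal of height `n + 1`. So `U` is a hyperplane, and the
  -- functional cutting it out has the coordinates of `p`.
  have hU : U ≠ ⊤ := by
    intro hU
    let M : Ideal (MvPolynomial (Fin (n + 1)) k) :=
      RingHom.ker (constantCoeff (R := k) (σ := Fin (n + 1)))
    have hM : M.IsMaximal := RingHom.ker_isMaximal_of_surjective _ fun x => ⟨C x, by simp⟩
    have hle : M ≤ Ideal.span s := by
      intro G hG
      rw [hspan, hU]
      have hX : Ideal.span (Set.range (X : Fin (n + 1) → MvPolynomial (Fin (n + 1)) k)) ≤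
          Ideal.span (Λ '' ((⊤ : Submodule k (Fin (n + 1) → k)) : Set _)) := by
        refine Ideal.span_mono ?_
        rintro _ ⟨i, rfl⟩
        exact ⟨Pi.single i 1, trivial, by simp [Λ]⟩
      refine hX ?_
      rw [← Set.image_univ, mem_ideal_span_X_image]
      intro m hm
      by_contra hcon
      push Not at hcon
      have : m = 0 := by
        ext i
        simpa using hcon i
      rw [mem_support_iff, this] at hm
      exact hm hG
    have h1 := Ideal.height_mono hle
    rw [hh, MvPolynomial.height_of_isMaximal] at h1
    have : n + 1 ≤ n := by exact_mod_cast h1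
    omega
  have hU' := Submodule.finrank_lt hU
  rw [Module.finrank_fin_fun] at hU'
  obtain ⟨φ, hφ0, hφ⟩ := Submodule.exists_le_ker_of_lt_top U (lt_top_iff_ne_top.mpr hU)
  have hUeq : U = LinearMap.ker φ := by
    refine Submodule.eq_of_le_of_finrank_le hφ ?_
    have := Module.Dual.finrank_ker_add_one_of_ne_zero hφ0
    rw [Module.finrank_fin_fun] at this
    omega
  let p : Fin (n + 1) → k := fun a => φ (Pi.single a 1)
  have hφp (v : Fin (n + 1) → k) : φ v = ∑ a, v a * p a := by
    conv_lhs => rw [← Finset.univ_sum_single v]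
    rw [map_sum]
    refine Finset.sum_congr rfl fun a _ => ?_
    rw [← mul_one (v a), ← smul_eq_mul, Pi.single_smul, map_smul, smul_eq_mul, smul_eq_mul,
      mul_one]
  have hp : p ≠ 0 := fun h => hφ0 (LinearMap.ext fun v => by simp [hφp, h])
  refine ⟨p, hp, ?_⟩
  rw [hspan]
  refine le_antisymm (Ideal.span_le.mpr ?_) (Ideal.span_le.mpr ?_)
  · rintro _ ⟨v, hv, rfl⟩
    have hv' : φ v = 0 := by
      rw [SetLike.mem_coe, hUeq] at hv
      exact hv
    refine mem_pointIdeal_of_isHomogeneous hp (e := 1) ?_ ?_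
    · rw [hΛ]
      exact IsHomogeneous.sum _ _ _ fun a _ => isHomogeneous_C_mul_X _ _
    · rw [hΛ, map_sum, ← hv', hφp]
      simp
  · rintro _ ⟨⟨i, j⟩, rfl⟩
    refine Ideal.subset_span ⟨p i • Pi.single j 1 - p j • Pi.single i 1, ?_, ?_⟩
    · rw [SetLike.mem_coe, hUeq, LinearMap.mem_ker, map_sub, map_smul, map_smul]
      simp only [smul_eq_mul]
      exact sub_eq_zero.mpr (mul_comm _ _)
    · rw [map_sub, map_smul, map_smul, smul_eq_C_mul, smul_eq_C_mul]
      simp [Λ]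

/-- Making `G` homogeneous with the help of the linear form `l`. -/
def homogenize (l G : MvPolynomial (Fin (r + 1)) k) : MvPolynomial (Fin (r + 1)) k :=
  ∑ e ∈ Finset.range (G.totalDegree + 1), l ^ (G.totalDegree - e) * homogeneousComponent e G

theorem isHomogeneous_homogenize {l : MvPolynomial (Fin (r + 1)) k} (hl : l.IsHomogeneous 1)
    (G : MvPolynomial (Fin (r + 1)) k) : (homogenize l G).IsHomogeneous G.totalDegree := by
  refine IsHomogeneous.sum _ _ _ fun e he => ?_
  have h := (hl.pow (G.totalDegree - e)).mul (homogeneousComponent_isHomogeneous e G)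
  have : 1 * (G.totalDegree - e) + e = G.totalDegree := by
    have := Finset.mem_range.mp he
    omega
  rwa [this] at h

theorem map_homogenize {A : Type*} [CommSemiring A] [Algebra k A]
    (φ : MvPolynomial (Fin (r + 1)) k →ₐ[k] A) {l : MvPolynomial (Fin (r + 1)) k} (hl : φ l = 1)
    (G : MvPolynomial (Fin (r + 1)) k) : φ (homogenize l G) = φ G := by
  conv_rhs => rw [← sum_homogeneousComponent G]
  simp [homogenize, hl]

end RowIdeals
end Forms
end

noncomputable section

namespace RowIdeals

attribute [local instance] MvPolynomial.gradedAlgebra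

/-! ### The dimension of the image, computed in affine charts. -/

section ImageDimension

variable {k : Type*} [Field k] {n r : ℕ}

theorem exists_X_notMem (x : ProjSpace k r) : ∃ i, X i ∉ x.asHomogeneousIdeal.toIdeal := by
  by_contra! h
  refine x.not_irrelevant_le fun G hG => ?_
  have h1 : coeff 0 G = 0 := by
    have : (DirectSum.decompose (homogeneousSubmodule (Fin (r + 1)) k) G 0 :
      MvPolynomial (Fin (r + 1)) k) = 0 := HomogeneousIdeal.mem_irrelevant_iff _ _ |>.mp hG
    rw [show (DirectSum.decompose (homogeneousSubmodule (Fin (r + 1)) k) G 0 :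
      MvPolynomial (Fin (r + 1)) k) = homogeneousComponent 0 G from
        decomposition.decompose'_apply G 0] at this
    simpa using this
  have h2 : G ∈ Ideal.span ((X : Fin (r + 1) → MvPolynomial (Fin (r + 1)) k) '' Set.univ) := by
    rw [mem_ideal_span_X_image]
    intro m hm
    by_contra! hcon
    have : m = 0 := by
      ext i
      simpa using hcon i
    rw [mem_support_iff, this] at hm
    exact hm h1
  refine Ideal.span_le.mpr ?_ h2
  rintro _ ⟨i, -, rfl⟩
  exact h i

/-- The generic point of `P^n` lies in the domain of `φ`, and vanishing at its image is the
condition on the right. Homogeneity is needed because image points are homogeneous cores. -/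
theorem mem_imageIdeal_iff {f : Fin (r + 1) → MvPolynomial (Fin (n + 1)) k} (hne : ∃ i, f i ≠ 0)
    {G : MvPolynomial (Fin (r + 1)) k} {e : ℕ} (hG : G.IsHomogeneous e) :
    G ∈ imageIdeal f ↔ bind₁ f G = 0 := by
  constructor
  · intro h
    let x : ProjSpace k n :=
      { asHomogeneousIdeal := ⊥
        isPrime := Ideal.isPrime_bot
        not_irrelevant_le := fun h => by
          have hX : (X 0 : MvPolynomial (Fin (n + 1)) k) ∈
              HomogeneousIdeal.irrelevant (homogeneousSubmodule (Fin (n + 1)) k) :=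
            HomogeneousIdeal.mem_irrelevant_of_mem _ one_pos (isHomogeneous_X k 0)
          exact X_ne_zero (R := k) 0 (h hX) }
    have hx : ∃ i, f i ∉ x.asHomogeneousIdeal.toIdeal := hne
    have h1 := (ProjectiveSpectrum.mem_vanishingIdeal _ _).mp h (ratMap f x hx) ⟨x, hx, rfl⟩
    exact Ideal.toIdeal_homogeneousCore_le _ _ h1
  · intro h
    refine (ProjectiveSpectrum.mem_vanishingIdeal _ _).mpr ?_
    rintro _ ⟨x, hx, rfl⟩
    refine Ideal.mem_homogeneousCore_of_homogeneous_of_mem ⟨e, hG⟩ ?_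
    rw [Ideal.mem_comap, h]
    exact Ideal.zero_mem _

/-- The points of the closed image of `φ`, ordered by inclusion of homogeneous primes. -/
abbrev ImagePoints (f : Fin (r + 1) → MvPolynomial (Fin (n + 1)) k) : Type _ :=
  {x : ProjSpace k r // imageIdeal f ≤ x.asHomogeneousIdeal.toIdeal}

theorem mem_closure_ratImage (f : Fin (r + 1) → MvPolynomial (Fin (n + 1)) k) (x : ProjSpace k r) :
    x ∈ closure (ratImage f) ↔ imageIdeal f ≤ x.asHomogeneousIdeal.toIdeal := by
  rw [← ProjectiveSpectrum.zeroLocus_vanishingIdeal_eq_closure]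
  exact ProjectiveSpectrum.mem_zeroLocus _ _ _

/-- Sobriety of `Proj`: irreducible closed sets correspond to their generic points, with the order
reversed. -/
theorem topologicalKrullDim_closure_ratImage (f : Fin (r + 1) → MvPolynomial (Fin (n + 1)) k) :
    topologicalKrullDim (closure (ratImage f)) = Order.krullDim (ImagePoints f) := by
  have : QuasiSober (ProjSpace k r) := inferInstanceAs
    (QuasiSober (AlgebraicGeometry.Proj (homogeneousSubmodule (Fin (r + 1)) k)))
  have : QuasiSober (closure (ratImage f)) :=
    isClosed_closure.isClosedEmbedding_subtypeVal.quasiSober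
  have hcl (x y : closure (ratImage f)) : x ∈ closure {y} ↔ y.1 ≤ x.1 := by
    rw [closure_subtype, Set.image_singleton, ProjectiveSpectrum.le_iff_mem_closure]
  rw [← Order.krullDim_orderDual (α := ImagePoints f)]
  refine le_antisymm ?_ ?_
  · let F : TopologicalSpace.IrreducibleCloseds (closure (ratImage f)) → (ImagePoints f)ᵒᵈ :=
      fun s => OrderDual.toDual ⟨s.isIrreducible.genericPoint.1,
        (mem_closure_ratImage f _).mp s.isIrreducible.genericPoint.2⟩
    have hF (s t) : s ≤ t ↔ F s ≤ F t := by
      change s ≤ t ↔ t.isIrreducible.genericPoint.1 ≤ s.isIrreducible.genericPoint.1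
      rw [← hcl, IsIrreducible.genericPoint_closure_eq, t.isClosed.closure_eq]
      constructor
      · intro h
        have := s.isIrreducible.isGenericPoint_genericPoint_closure.mem
        rw [s.isClosed.closure_eq] at this
        exact h this
      · intro h
        have h1 := s.isIrreducible.genericPoint_closure_eq
        rw [s.isClosed.closure_eq] at h1
        rw [← SetLike.coe_subset_coe, ← h1]
        exact closure_minimal (Set.singleton_subset_iff.mpr h) t.isClosed
    exact Order.krullDim_le_of_strictMono F fun s t hst => by
      rw [lt_iff_le_not_ge, ← hF, ← hF]
      exact lt_iff_le_not_ge.mp hst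
  · let F : (ImagePoints f)ᵒᵈ → TopologicalSpace.IrreducibleCloseds (closure (ratImage f)) :=
      fun x => ⟨closure {⟨(OrderDual.ofDual x).1, (mem_closure_ratImage f _).mpr
        (OrderDual.ofDual x).2⟩}, isIrreducible_singleton.closure, isClosed_closure⟩
    have hF (x y) : x ≤ y ↔ F x ≤ F y := by
      change _ ↔ closure _ ⊆ closure _
      rw [isClosed_closure.closure_subset_iff, Set.singleton_subset_iff, hcl]
      rfl
    exact Order.krullDim_le_of_strictMono F fun s t hst => by
      rw [lt_iff_le_not_ge, ← hF, ← hF]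
      exact lt_iff_le_not_ge.mp hst

/-- The substitution `y_j ↦ f_j / h`. -/
def ratioHom (f : Fin (r + 1) → MvPolynomial (Fin (n + 1)) k) (h : MvPolynomial (Fin (n + 1)) k) :
    MvPolynomial (Fin (r + 1)) k →ₐ[k] Localization.Away h :=
  aeval fun j => IsLocalization.Away.invSelf h * algebraMap _ _ (f j)

variable (f : Fin (r + 1) → MvPolynomial (Fin (n + 1)) k)

theorem ratioHom_of_isHomogeneous (h : MvPolynomial (Fin (n + 1)) k)
    {G : MvPolynomial (Fin (r + 1)) k} {e : ℕ} (hG : G.IsHomogeneous e) :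
    ratioHom f h G = IsLocalization.Away.invSelf h ^ e * algebraMap _ _ (bind₁ f G) := by
  rw [ratioHom, hG.aeval_mul_left]
  congr 1
  exact aeval_algebraMap_apply (Localization.Away h) f G

theorem ratioHom_eq_one {l : MvPolynomial (Fin (r + 1)) k} (hl : l.IsHomogeneous 1) :
    ratioHom f (bind₁ f l) l = 1 := by
  rw [ratioHom_of_isHomogeneous f _ hl, pow_one, mul_comm]
  exact IsLocalization.Away.mul_invSelf _

theorem ratioHom_eq_zero_iff {h : MvPolynomial (Fin (n + 1)) k} (hh : h ≠ 0)
    {G : MvPolynomial (Fin (r + 1)) k} {e : ℕ} (hG : G.IsHomogeneous e) :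
    ratioHom f h G = 0 ↔ bind₁ f G = 0 := by
  rw [ratioHom_of_isHomogeneous f h hG]
  have hu : IsUnit (IsLocalization.Away.invSelf h : Localization.Away h) :=
    .of_mul_eq_one _ (by rw [mul_comm]; exact IsLocalization.Away.mul_invSelf h)
  rw [(hu.pow e).mul_right_eq_zero, map_eq_zero_iff]
  exact IsLocalization.injective _ (powers_le_nonZeroDivisors_of_noZeroDivisors hh)

/-- A prime of the chart ring goes to the homogeneous prime of forms vanishing on it. No prime is
lost: `l` maps to `1`, so homogenizing with `l` does not change the value of a polynomial on the
chart. -/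
theorem ringKrullDim_range_ratioHom_le (hne : ∃ i, f i ≠ 0) {l : MvPolynomial (Fin (r + 1)) k}
    (hl : l.IsHomogeneous 1) :
    ringKrullDim (ratioHom f (bind₁ f l)).range ≤ topologicalKrullDim (closure (ratImage f)) := by
  rw [topologicalKrullDim_closure_ratImage]
  let ρ := (ratioHom f (bind₁ f l)).rangeRestrict
  have hρl : ρ l = 1 := Subtype.ext (ratioHom_eq_one f hl)
  let F : PrimeSpectrum (ratioHom f (bind₁ f l)).range → ImagePoints f := fun q =>
    ⟨{ asHomogeneousIdeal := (q.asIdeal.comap ρ).homogeneousCore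
        (homogeneousSubmodule (Fin (r + 1)) k)
       isPrime := (q.isPrime.comap ρ).homogeneousCore
       not_irrelevant_le := fun h => by
        have h1 : l ∈ HomogeneousIdeal.irrelevant (homogeneousSubmodule (Fin (r + 1)) k) :=
          HomogeneousIdeal.mem_irrelevant_of_mem _ one_pos hl
        have h2 := Ideal.toIdeal_homogeneousCore_le _ _ (h h1)
        rw [Ideal.mem_comap, hρl] at h2
        exact q.isPrime.ne_top ((Ideal.eq_top_iff_one _).mpr h2) }, by
      intro G hG
      have hhom : (imageIdeal f).IsHomogeneous (homogeneousSubmodule (Fin (r + 1)) k) :=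
        (ProjectiveSpectrum.vanishingIdeal (ratImage f)).isHomogeneous
      rw [← sum_homogeneousComponent G]
      refine Ideal.sum_mem _ fun e _ => ?_
      refine Ideal.mem_homogeneousCore_of_homogeneous_of_mem
        ⟨e, homogeneousComponent_isHomogeneous e G⟩ ?_
      have h1 := homogeneousComponent_mem_of_mem hhom hG e
      rw [mem_imageIdeal_iff hne (homogeneousComponent_isHomogeneous e G)] at h1
      have h2 : ρ (homogeneousComponent e G) = 0 := Subtype.ext (by
        change ratioHom f (bind₁ f l) (homogeneousComponent e G) = 0
        rw [ratioHom_of_isHomogeneous f _ (homogeneousComponent_isHomogeneous e G), h1, map_zero,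
          mul_zero])
      rw [Ideal.mem_comap, h2]
      exact Ideal.zero_mem _⟩
  refine Order.krullDim_le_of_strictMono F fun q₁ q₂ hq => ?_
  refine lt_of_le_of_ne ?_ fun heq => ?_
  · exact Ideal.homogeneousCore_mono _ (Ideal.comap_mono hq.le)
  · obtain ⟨b, hb₂, hb₁⟩ := SetLike.exists_of_lt (show q₁.asIdeal < q₂.asIdeal from hq)
    obtain ⟨G, rfl⟩ := (ratioHom f (bind₁ f l)).rangeRestrict_surjective b
    have hG : ρ (homogenize l G) = ρ G := map_homogenize ρ hρl G
    have h2 : homogenize l G ∈ (F q₂).1.asHomogeneousIdeal.toIdeal :=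
      Ideal.mem_homogeneousCore_of_homogeneous_of_mem ⟨_, isHomogeneous_homogenize hl G⟩
        (by rw [Ideal.mem_comap, hG]; exact hb₂)
    rw [← heq] at h2
    have h3 := Ideal.toIdeal_homogeneousCore_le _ _ h2
    rw [Ideal.mem_comap, hG] at h3
    exact hb₁ h3

/-- The substitution `y_j ↦ y_j / y_i` on the variety with homogeneous prime `x`. -/
def chartHom (x : ProjSpace k r) (i : Fin (r + 1)) : MvPolynomial (Fin (r + 1)) k →ₐ[k]
    FractionRing (MvPolynomial (Fin (r + 1)) k ⧸ x.asHomogeneousIdeal.toIdeal) :=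
  aeval fun j => (algebraMap (MvPolynomial (Fin (r + 1)) k ⧸ x.asHomogeneousIdeal.toIdeal) _
      (Ideal.Quotient.mk _ (X i)))⁻¹ *
    algebraMap (MvPolynomial (Fin (r + 1)) k ⧸ x.asHomogeneousIdeal.toIdeal) _
      (Ideal.Quotient.mk _ (X j))

variable {x : ProjSpace k r} {i : Fin (r + 1)}

theorem chartHom_eq_zero_iff_of_isHomogeneous (hi : X i ∉ x.asHomogeneousIdeal.toIdeal)
    {G : MvPolynomial (Fin (r + 1)) k} {e : ℕ} (hG : G.IsHomogeneous e) :
    chartHom x i G = 0 ↔ G ∈ x.asHomogeneousIdeal.toIdeal := by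
  let D := MvPolynomial (Fin (r + 1)) k ⧸ x.asHomogeneousIdeal.toIdeal
  have h1 : (algebraMap D (FractionRing D) (Ideal.Quotient.mk _ (X i))) ≠ 0 := by
    rw [Ne, map_eq_zero_iff _ (IsFractionRing.injective D _), Ideal.Quotient.eq_zero_iff_mem]
    exact hi
  have h2 : aeval (fun j => algebraMap D (FractionRing D) (Ideal.Quotient.mk _ (X j))) G =
      algebraMap D (FractionRing D) (Ideal.Quotient.mk _ G) := by
    let φ : MvPolynomial (Fin (r + 1)) k →ₐ[k] FractionRing D :=
      (IsScalarTower.toAlgHom k D (FractionRing D)).comp (Ideal.Quotient.mkₐ k _)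
    have := DFunLike.congr_fun (aeval_unique φ) G
    exact this.symm
  rw [chartHom, hG.aeval_mul_left]
  change _ * aeval (fun j => algebraMap D (FractionRing D) (Ideal.Quotient.mk _ (X j))) G = 0 ↔ _
  rw [h2, mul_eq_zero_iff_left (pow_ne_zero _ (inv_ne_zero h1)),
    map_eq_zero_iff _ (IsFractionRing.injective D _), Ideal.Quotient.eq_zero_iff_mem]

theorem chartHom_eq_zero_iff (hi : X i ∉ x.asHomogeneousIdeal.toIdeal)
    (G : MvPolynomial (Fin (r + 1)) k) :
    chartHom x i G = 0 ↔ homogenize (X i) G ∈ x.asHomogeneousIdeal.toIdeal := by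
  rw [← chartHom_eq_zero_iff_of_isHomogeneous hi (isHomogeneous_homogenize (isHomogeneous_X k i) G),
    map_homogenize]
  let D := MvPolynomial (Fin (r + 1)) k ⧸ x.asHomogeneousIdeal.toIdeal
  have h1 : (algebraMap D (FractionRing D) (Ideal.Quotient.mk _ (X i))) ≠ 0 := by
    rw [Ne, map_eq_zero_iff _ (IsFractionRing.injective D _), Ideal.Quotient.eq_zero_iff_mem]
    exact hi
  rw [chartHom, aeval_X]
  exact inv_mul_cancel₀ h1

/-- A chain of homogeneous primes lies in a single chart: a variable outside the largest prime is
outside all of them. Points of that chart embed strictly monotonically into the spectrum of its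
ring. -/
theorem topologicalKrullDim_closure_ratImage_le (hne : ∀ i, f i ≠ 0) {N : WithBot ℕ∞}
    (hN : ∀ i, ringKrullDim (ratioHom f (f i)).range ≤ N) :
    topologicalKrullDim (closure (ratImage f)) ≤ N := by
  rw [topologicalKrullDim_closure_ratImage]
  refine iSup_le fun s => ?_
  obtain ⟨i, hi⟩ := exists_X_notMem s.last.1
  refine le_trans ?_ (hN i)
  let ρ := (ratioHom f (f i)).rangeRestrict
  have hρ : Function.Surjective ρ := (ratioHom f (f i)).rangeRestrict_surjective
  have hker (x : ImagePoints f) (hx : X i ∉ x.1.asHomogeneousIdeal.toIdeal) :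
      RingHom.ker ρ ≤ RingHom.ker (chartHom x.1 i) := by
    intro G hG
    have h1 : ratioHom f (f i) G = 0 := congrArg Subtype.val hG
    have h2 : ratioHom f (f i) (X i) = 1 := by
      have := ratioHom_eq_one f (isHomogeneous_X k i)
      rwa [bind₁_X_right] at this
    rw [← map_homogenize _ h2, ratioHom_eq_zero_iff f (hne i)
      (isHomogeneous_homogenize (isHomogeneous_X k i) G),
      ← mem_imageIdeal_iff ⟨i, hne i⟩ (isHomogeneous_homogenize (isHomogeneous_X k i) G)] at h1
    exact (chartHom_eq_zero_iff hx G).mpr (x.2 h1)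
  let Y := {x : ImagePoints f // X i ∉ x.1.asHomogeneousIdeal.toIdeal}
  have hprime (x : Y) : (RingHom.ker (chartHom x.1.1 i)).IsPrime := RingHom.ker_isPrime _
  let F : Y → PrimeSpectrum (ratioHom f (f i)).range := fun x =>
    ⟨(RingHom.ker (chartHom x.1.1 i)).map ρ,
      Ideal.map_isPrime_of_surjective hρ (hker x.1 x.2)⟩
  have hcomap (x : Y) : (F x).asIdeal.comap ρ = RingHom.ker (chartHom x.1.1 i) := by
    change ((RingHom.ker (chartHom x.1.1 i)).map ρ).comap ρ = _
    rw [Ideal.comap_map_of_surjective _ hρ]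
    exact sup_eq_left.mpr (hker x.1 x.2)
  have hF : StrictMono F := by
    intro x y hxy
    have hle : RingHom.ker (chartHom x.1.1 i) ≤ RingHom.ker (chartHom y.1.1 i) := by
      intro G hG
      exact (chartHom_eq_zero_iff y.2 G).mpr (hxy.le ((chartHom_eq_zero_iff x.2 G).mp hG))
    refine lt_of_le_of_ne (Ideal.map_mono hle) fun heq => ?_
    refine hxy.not_ge fun G hG => ?_
    have h1 : RingHom.ker (chartHom x.1.1 i) = RingHom.ker (chartHom y.1.1 i) := by
      rw [← hcomap, ← hcomap, heq]
    change G ∈ x.1.1.asHomogeneousIdeal.toIdeal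
    have hhom := y.1.1.asHomogeneousIdeal.isHomogeneous
    rw [← sum_homogeneousComponent G]
    refine Ideal.sum_mem _ fun e _ => ?_
    have h2 : homogeneousComponent e G ∈ y.1.1.asHomogeneousIdeal.toIdeal :=
      homogeneousComponent_mem_of_mem hhom hG e
    rw [← chartHom_eq_zero_iff_of_isHomogeneous y.2 (homogeneousComponent_isHomogeneous e G),
      ← RingHom.mem_ker, ← h1] at h2
    exact (chartHom_eq_zero_iff_of_isHomogeneous x.2
      (homogeneousComponent_isHomogeneous e G)).mp h2
  let s' : LTSeries Y :=
    { length := s.length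
      toFun := fun j => ⟨s j, fun h => hi (LTSeries.monotone s (Fin.le_last j) h)⟩
      step := fun j => s.step j }
  exact Order.LTSeries.length_le_krullDim (s'.map F hF)

end ImageDimension

end RowIdeals
end

/-! ### Morphism fibre ideals and the two bounds for their height. -/

noncomputable section

theorem Ideal.pow_le_sup_span_pow {R : Type*} [CommRing R] {I J : Ideal R} {h : R}
    (hI : I ≤ J ⊔ Ideal.span {h}) (m : ℕ) : I ^ m ≤ J ⊔ Ideal.span {h ^ m} := by
  induction m with
  | zero => simp
  | succ m ih =>
    rw [pow_succ]
    refine (Ideal.mul_mono ih hI).trans (Ideal.mul_le.mpr fun x hx y hy => ?_)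
    obtain ⟨u, hu, v, hv, rfl⟩ := Submodule.mem_sup.mp hx
    obtain ⟨u', hu', v', hv', rfl⟩ := Submodule.mem_sup.mp hy
    obtain ⟨c, rfl⟩ := Ideal.mem_span_singleton'.mp hv
    obtain ⟨c', rfl⟩ := Ideal.mem_span_singleton'.mp hv'
    rw [show (u + c * h ^ m) * (u' + c' * h) =
      (u' + c' * h) * u + c * h ^ m * u' + c * c' * h ^ (m + 1) by ring]
    exact Ideal.add_mem _ (Ideal.mem_sup_left (J.add_mem (J.mul_mem_left _ hu)
      (J.mul_mem_left _ hu'))) (Ideal.mem_sup_right (Ideal.mul_mem_left _ _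
        (Ideal.mem_span_singleton_self _)))

namespace RowIdeals

attribute [local instance] MvPolynomial.gradedAlgebra

section FibreIdeals

variable {k : Type*} [Field k] {n r d : ℕ} {f : Fin (r + 1) → MvPolynomial (Fin (n + 1)) k}

theorem exists_bind₁_eq_of_mem_formSpace {w : MvPolynomial (Fin (n + 1)) k}
    (hw : w ∈ formSpace f) : ∃ l : MvPolynomial (Fin (r + 1)) k, l.IsHomogeneous 1 ∧
      bind₁ f l = w := by
  obtain ⟨c, rfl⟩ := (Submodule.mem_span_range_iff_exists_fun k).mp hw
  refine ⟨∑ j, C (c j) * X j, IsHomogeneous.sum _ _ _ fun j _ => isHomogeneous_C_mul_X _ _, ?_⟩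
  simp [smul_eq_C_mul]

theorem mem_formSpace (f : Fin (r + 1) → MvPolynomial (Fin (n + 1)) k) (i : Fin (r + 1)) :
    f i ∈ formSpace f :=
  Submodule.subset_span ⟨i, rfl⟩

theorem isHomogeneous_of_mem_formSpace (hf : ∀ i, (f i).IsHomogeneous d)
    {w : MvPolynomial (Fin (n + 1)) k} (hw : w ∈ formSpace f) : w.IsHomogeneous d := by
  have : formSpace f ≤ homogeneousSubmodule (Fin (n + 1)) k d :=
    Submodule.span_le.mpr (by rintro _ ⟨i, rfl⟩; exact hf i)
  exact this hw

variable (q : TargetPoint (formSpace f))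

theorem TargetPoint.exists_mem_notMem : ∃ h ∈ formSpace f, h ∉ q.space := by
  by_contra! hcon
  have h1 := q.finrank_add_one
  rw [le_antisymm q.space_le hcon] at h1
  omega

variable {q} {h : MvPolynomial (Fin (n + 1)) k}

theorem TargetPoint.exists_sub_smul_mem (hW : h ∈ formSpace f) (hq : h ∉ q.space)
    {w : MvPolynomial (Fin (n + 1)) k} (hw : w ∈ formSpace f) : ∃ c : k, w - c • h ∈ q.space := by
  have hfin : FiniteDimensional k (formSpace f) :=
    FiniteDimensional.span_of_finite k (Set.finite_range f)
  have hlt : q.space < q.space ⊔ Submodule.span k {h} :=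
    lt_of_le_of_ne le_sup_left fun heq => hq (heq ▸ Submodule.mem_sup_right
      (Submodule.mem_span_singleton_self h))
  have hle : q.space ⊔ Submodule.span k {h} ≤ formSpace f :=
    sup_le q.space_le (by simpa using hW)
  have : FiniteDimensional k (q.space ⊔ Submodule.span k {h} : Submodule k _) :=
    Submodule.finiteDimensional_of_le hle
  have hfr := Submodule.finrank_lt_finrank_of_lt hlt
  have heq := Submodule.eq_of_le_of_finrank_le hle (by
    have := q.finrank_add_one
    omega)
  rw [← heq] at hw
  obtain ⟨u, hu, v, hv, rfl⟩ := Submodule.mem_sup.mp hw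
  obtain ⟨c, rfl⟩ := Submodule.mem_span_singleton.mp hv
  exact ⟨c, by simpa using hu⟩

theorem formIdeal_le_sup (hW : h ∈ formSpace f) (hq : h ∉ q.space) :
    formIdeal f ≤ q.ideal ⊔ Ideal.span {h} := by
  refine Ideal.span_le.mpr ?_
  rintro _ ⟨i, rfl⟩
  obtain ⟨c, hc⟩ := q.exists_sub_smul_mem hW hq (mem_formSpace f i)
  rw [SetLike.mem_coe, ← sub_add_cancel (f i) (c • h), smul_eq_C_mul]
  rw [smul_eq_C_mul] at hc
  exact Ideal.add_mem _ (Ideal.mem_sup_left (Ideal.subset_span hc))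
    (Ideal.mem_sup_right (Ideal.mul_mem_left _ _ (Ideal.mem_span_singleton_self h)))

theorem mem_formIdeal_of_mem_formSpace (hW : h ∈ formSpace f) : h ∈ formIdeal f :=
  Submodule.span_le_restrictScalars k (MvPolynomial (Fin (n + 1)) k) _ hW

/-- Since `I^m ⊆ I_q + (h^m)`, saturating by `I` amounts to saturating by the single element `h`. -/
theorem mem_morphismFiberIdeal_iff (hW : h ∈ formSpace f) (hq : h ∉ q.space)
    (s : MvPolynomial (Fin (n + 1)) k) :
    s ∈ morphismFiberIdeal f q ↔ ∃ m : ℕ, h ^ m * s ∈ q.ideal := by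
  have hmono : Monotone fun m : ℕ => q.ideal.colon
      ((formIdeal f ^ m : Ideal (MvPolynomial (Fin (n + 1)) k)) : Set _) := by
    intro a b hab s hs
    exact Submodule.mem_colon.mpr fun t ht =>
      Submodule.mem_colon.mp hs t (Ideal.pow_le_pow_right hab ht)
  rw [morphismFiberIdeal, saturation, Submodule.mem_iSup_of_directed _ hmono.directed_le]
  refine exists_congr fun m => ?_
  rw [Submodule.mem_colon]
  constructor
  · intro hs
    have := hs (h ^ m) (Ideal.pow_mem_pow (mem_formIdeal_of_mem_formSpace hW) m)
    rwa [smul_eq_mul, mul_comm] at this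
  · intro hs t ht
    have hpow := Ideal.pow_le_sup_span_pow (formIdeal_le_sup hW hq) m
    obtain ⟨u, hu, v, hv, rfl⟩ := Submodule.mem_sup.mp (hpow ht)
    obtain ⟨c, rfl⟩ := Ideal.mem_span_singleton'.mp hv
    rw [smul_eq_mul, mul_add]
    refine Ideal.add_mem _ (Ideal.mul_mem_left _ _ hu) ?_
    rw [show s * (c * h ^ m) = c * (h ^ m * s) by ring]
    exact Ideal.mul_mem_left _ _ hs

theorem height_morphismFiberIdeal (hW : h ∈ formSpace f) (hq : h ∉ q.space) :
    (morphismFiberIdeal f q).height =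
      (q.ideal.map (algebraMap _ (Localization.Away h))).height := by
  rw [← IsLocalization.height_under (Submonoid.powers h)
    (q.ideal.map (algebraMap _ (Localization.Away h)))]
  congr 1
  ext s
  rw [mem_morphismFiberIdeal_iff hW hq, Ideal.mem_comap,
    IsLocalization.algebraMap_mem_map_algebraMap_iff (Submonoid.powers h)]
  constructor
  · rintro ⟨m, hm⟩
    exact ⟨_, ⟨m, rfl⟩, hm⟩
  · rintro ⟨_, ⟨m, rfl⟩, hm⟩
    exact ⟨m, hm⟩

theorem map_ideal_ne_top (hW : h ∈ formSpace f) (hq : h ∉ q.space)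
    (hne : morphismFiberIdeal f q ≠ ⊤) :
    q.ideal.map (algebraMap _ (Localization.Away h)) ≠ ⊤ := by
  intro htop
  refine hne ((Ideal.eq_top_iff_one _).mpr ((mem_morphismFiberIdeal_iff hW hq 1).mpr ?_))
  have h1 : algebraMap (MvPolynomial (Fin (n + 1)) k) (Localization.Away h) 1 ∈
      q.ideal.map (algebraMap _ (Localization.Away h)) := htop ▸ Submodule.mem_top
  obtain ⟨_, ⟨m, rfl⟩, hm⟩ :=
    (IsLocalization.algebraMap_mem_map_algebraMap_iff (Submonoid.powers h) _ _ _).mp h1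
  exact ⟨m, hm⟩

instance (h : MvPolynomial (Fin (n + 1)) k) : Algebra.FiniteType k (ratioHom f h).range :=
  .of_surjective (ratioHom f h).rangeRestrict (ratioHom f h).rangeRestrict_surjective

theorem algebraMap_eq_mul_ratioHom (h : MvPolynomial (Fin (n + 1)) k)
    {l : MvPolynomial (Fin (r + 1)) k} (hl : l.IsHomogeneous 1) :
    algebraMap _ (Localization.Away h) (bind₁ f l) = algebraMap _ _ h * ratioHom f h l := by
  rw [ratioHom_of_isHomogeneous f h hl, pow_one, ← mul_assoc, IsLocalization.Away.mul_invSelf,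
    one_mul]

theorem ratioHom_mem_of_mem {l : MvPolynomial (Fin (r + 1)) k} (hl : l.IsHomogeneous 1)
    {Q : Ideal (Localization.Away h)} (hQ : algebraMap _ (Localization.Away h) (bind₁ f l) ∈ Q) :
    ratioHom f h l ∈ Q := by
  rw [ratioHom_of_isHomogeneous f h hl]
  exact Ideal.mul_mem_left _ _ hQ

/-- For a minimal prime `Q` of `I_q S_h`, each generator is `h` times an element of `Q ∩ B`, so `I_q
S_h ⊆ (Q ∩ B) S_h ⊆ Q`. Minimality passes to the middle ideal, and the fibre term in the height
inequality for `B → S_h` vanishes. -/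
theorem height_map_ideal_le (hh : h ≠ 0)
    (hne : q.ideal.map (algebraMap _ (Localization.Away h)) ≠ ⊤) :
    ((q.ideal.map (algebraMap _ (Localization.Away h))).height : WithBot ℕ∞) ≤
      ringKrullDim (ratioHom f h).range := by
  let T := Localization.Away h
  let B := (ratioHom f h).range
  have : IsDomain T := IsLocalization.isDomain_localization
    (powers_le_nonZeroDivisors_of_noZeroDivisors hh)
  have : IsNoetherianRing B := Algebra.FiniteType.isNoetherianRing k B
  obtain ⟨Q, hQ⟩ := Ideal.nonempty_minimalPrimes hne
  have hQp : Q.IsPrime := hQ.isPrime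
  have hle : q.ideal.map (algebraMap _ T) ≤ (Q.under B).map (algebraMap B T) := by
    rw [TargetPoint.ideal, Ideal.map_span, Ideal.span_le]
    rintro _ ⟨w, hw, rfl⟩
    obtain ⟨l, hl, rfl⟩ := exists_bind₁_eq_of_mem_formSpace (q.space_le hw)
    have hwQ : algebraMap _ T (bind₁ f l) ∈ Q :=
      hQ.le (Ideal.mem_map_of_mem _ (Ideal.subset_span hw))
    rw [SetLike.mem_coe, algebraMap_eq_mul_ratioHom h hl]
    refine Ideal.mul_mem_left _ _ ?_
    exact Ideal.mem_map_of_mem (algebraMap B T)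
      (x := (⟨ratioHom f h l, l, rfl⟩ : B)) (ratioHom_mem_of_mem hl hwQ)
  have h1 := Ideal.height_le_height_add_of_liesOver (Q.under B) Q
  have hQB : (Q.under B).map (algebraMap B T) ≤ Q := Ideal.map_comap_le
  have hpr : (Q.map (Ideal.Quotient.mk ((Q.under B).map (algebraMap B T)))).IsPrime :=
    Ideal.isPrime_map_quotientMk_of_isPrime hQB
  have h2 : (Q.map (Ideal.Quotient.mk ((Q.under B).map (algebraMap B T)))).height = 0 := by
    rw [Ideal.height_eq_zero_iff]
    refine ⟨⟨hpr, bot_le⟩, fun p' hp' hp'le => ?_⟩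
    have hpp : p'.IsPrime := hp'.1
    have hc : Q ≤ p'.comap (Ideal.Quotient.mk ((Q.under B).map (algebraMap B T))) := by
      refine hQ.2 ⟨Ideal.IsPrime.comap _, hle.trans ?_⟩ ?_
      · intro x hx
        rw [Ideal.mem_comap, Ideal.Quotient.eq_zero_iff_mem.mpr hx]
        exact Ideal.zero_mem _
      · refine (Ideal.comap_mono hp'le).trans ?_
        rw [Ideal.comap_map_of_surjective _ Ideal.Quotient.mk_surjective]
        refine sup_le le_rfl ?_
        intro x hx
        exact hQB (Ideal.Quotient.eq_zero_iff_mem.mp hx)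
    exact Ideal.map_le_iff_le_comap.mpr hc
  rw [h2, add_zero] at h1
  calc ((q.ideal.map (algebraMap _ T)).height : WithBot ℕ∞) ≤ Q.height :=
        WithBot.coe_le_coe.mpr (Ideal.height_mono hQ.le)
    _ ≤ (Q.under B).height := WithBot.coe_le_coe.mpr h1
    _ ≤ ringKrullDim B := Ideal.height_le_ringKrullDim_of_isPrime

theorem height_morphismFiberIdeal_le (hne : morphismFiberIdeal f q ≠ ⊤) :
    ((morphismFiberIdeal f q).height : WithBot ℕ∞) ≤
      topologicalKrullDim (closure (ratImage f)) := by
  obtain ⟨h, hW, hq⟩ := q.exists_mem_notMem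
  have hh : h ≠ 0 := fun h0 => hq (h0 ▸ q.space.zero_mem)
  obtain ⟨l, hl, rfl⟩ := exists_bind₁_eq_of_mem_formSpace hW
  rw [height_morphismFiberIdeal hW hq]
  refine (height_map_ideal_le hh (map_ideal_ne_top hW hq hne)).trans
    (ringKrullDim_range_ratioHom_le f ?_ hl)
  by_contra! hcon
  refine hh ?_
  -- Writing the zero tuple as `0 * 0` lets the scaling rule for forms of degree one give `l(0) =
  -- 0`.
  rw [show f = fun i => (0 : MvPolynomial (Fin (n + 1)) k) * 0 from funext fun i => by simp [hcon i]]
  change aeval (fun i => (0 : MvPolynomial (Fin (n + 1)) k) * 0) l = 0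
  rw [hl.aeval_mul_left, pow_one, zero_mul]

variable {p : Projectivization k (Fin (n + 1) → k)}

theorem mem_imagePoint_space (hp : IsRegularAt f p) {w : MvPolynomial (Fin (n + 1)) k} :
    w ∈ (imagePoint f p hp).space ↔ w ∈ formSpace f ∧ eval p.rep w = 0 := by
  rw [imagePoint, Submodule.mem_inf, LinearMap.mem_ker]
  rfl

theorem ideal_imagePoint_le (hf : ∀ i, (f i).IsHomogeneous d) (hp : IsRegularAt f p) :
    (imagePoint f p hp).ideal ≤ pointIdeal p.rep := by
  refine Ideal.span_le.mpr fun w hw => ?_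
  obtain ⟨hw, h0⟩ := (mem_imagePoint_space hp).mp hw
  exact mem_pointIdeal_of_isHomogeneous p.rep_nonzero (isHomogeneous_of_mem_formSpace hf hw) h0

/-- The point ideal is prime, contains `I_φ(p)` and omits some `f i`, so saturation stays inside it.
-/
theorem morphismFiberIdeal_imagePoint_le (hf : ∀ i, (f i).IsHomogeneous d) (hp : IsRegularAt f p) :
    morphismFiberIdeal f (imagePoint f p hp) ≤ pointIdeal p.rep := by
  obtain ⟨i, hi⟩ := id hp
  intro s hs
  obtain ⟨m, hm⟩ := (mem_morphismFiberIdeal_iff (mem_formSpace f i)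
    (fun h => hi ((mem_imagePoint_space hp).mp h).2) s).mp hs
  have hpr := isPrime_pointIdeal p.rep_nonzero
  refine (hpr.mem_or_mem (ideal_imagePoint_le hf hp hm)).resolve_left fun h => hi ?_
  exact eval_eq_zero_of_mem_pointIdeal (hpr.mem_of_pow_mem m h)

theorem morphismFiberIdeal_imagePoint_ne_top (hf : ∀ i, (f i).IsHomogeneous d)
    (hp : IsRegularAt f p) : morphismFiberIdeal f (imagePoint f p hp) ≠ ⊤ := fun h =>
  (isPrime_pointIdeal p.rep_nonzero).ne_top
    (top_le_iff.mp (h ▸ morphismFiberIdeal_imagePoint_le hf hp))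

theorem eval_bind₁ (v : Fin (n + 1) → k) (G : MvPolynomial (Fin (r + 1)) k) :
    eval v (bind₁ f G) = eval (fun j => eval v (f j)) G := by
  rw [← aeval_eq_eval, ← aeval_eq_eval, aeval_bind₁]

/-- The general fibres have codimension at least the dimension of a chart of the image. -/
theorem exists_ringKrullDim_le_height (hf : ∀ i, (f i).IsHomogeneous d) {i : Fin (r + 1)}
    (hi : f i ≠ 0) : ∃ (g : MvPolynomial (Fin (n + 1)) k) (e : ℕ), g ≠ 0 ∧ g.IsHomogeneous e ∧
      ∀ p : Projectivization k (Fin (n + 1) → k), eval p.rep g ≠ 0 → eval p.rep (f i) ≠ 0 →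
        ∀ hp : IsRegularAt f p, ringKrullDim (ratioHom f (f i)).range ≤
          (morphismFiberIdeal f (imagePoint f p hp)).height := by
  let T := Localization.Away (f i)
  let B := (ratioHom f (f i)).range
  have : IsDomain T := IsLocalization.isDomain_localization
    (powers_le_nonZeroDivisors_of_noZeroDivisors hi)
  obtain ⟨b, hb, hdim⟩ := exists_ne_zero_forall_ringKrullDim_le_height k B T
  obtain ⟨G, rfl⟩ := (ratioHom f (f i)).rangeRestrict_surjective b
  have hone : ratioHom f (f i) (X i) = 1 := by
    have := ratioHom_eq_one f (isHomogeneous_X k i)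
    rwa [bind₁_X_right] at this
  have hH := isHomogeneous_homogenize (isHomogeneous_X k i) G
  -- The exceptional function `b` on the chart is `G(f / f_i)`; homogenizing `G` turns its
  -- nonvanishing into that of a form on `P^n`.
  refine ⟨bind₁ f (homogenize (X i) G), d * G.totalDegree, ?_, hH.aeval f hf, ?_⟩
  · rw [Ne, ← ratioHom_eq_zero_iff f hi hH, map_homogenize _ hone]
    exact fun h => hb (Subtype.ext h)
  intro p hg hpi hp
  have hiq : f i ∉ (imagePoint f p hp).space := fun h => hpi ((mem_imagePoint_space hp).mp h).2
  rw [height_morphismFiberIdeal (mem_formSpace f i) hiq, Ideal.height_eq_inf_minimalPrimes]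
  have hall : ∀ Q ∈ ((imagePoint f p hp).ideal.map (algebraMap _ T)).minimalPrimes,
      ringKrullDim B ≤ Q.height := by
    intro Q hQ
    have hQp : Q.IsPrime := hQ.isPrime
    let c : Fin (r + 1) → k := fun j => (eval p.rep (f i))⁻¹ * eval p.rep (f j)
    have hlin (j : Fin (r + 1)) : ratioHom f (f i) (X j - C (c j)) ∈ Q := by
      have h1 : ratioHom f (f i) (X j - C (c j)) = ratioHom f (f i) (X j - C (c j) * X i) := by
        rw [map_sub, map_sub, map_mul (ratioHom f (f i)) (C (c j)) (X i), hone, mul_one]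
      rw [h1]
      refine ratioHom_mem_of_mem ((isHomogeneous_X k j).sub (isHomogeneous_C_mul_X _ _)) ?_
      refine hQ.le (Ideal.mem_map_of_mem _ (Ideal.subset_span ?_))
      rw [SetLike.mem_coe, mem_imagePoint_space]
      rw [map_sub, map_mul, bind₁_X_right, bind₁_X_right, bind₁_C_right]
      refine ⟨?_, ?_⟩
      · rw [← smul_eq_C_mul]
        exact Submodule.sub_mem _ (mem_formSpace f j) (Submodule.smul_mem _ _ (mem_formSpace f i))
      · simp only [map_sub, map_mul, eval_C, c]
        field_simp
        ring
    -- Modulo `Q` every chart function equals its value at `φ(p)`, whose affine coordinates are `c`.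
    -- Hence `Q ∩ B` is the maximal ideal of that point.
    have hval (H : MvPolynomial (Fin (r + 1)) k) :
        ratioHom f (f i) H - algebraMap k T (eval c H) ∈ Q := by
      have h1 : (Ideal.Quotient.mkₐ k Q).comp (ratioHom f (f i)) =
          (Algebra.ofId k (T ⧸ Q)).comp (aeval c) := by
        ext1 j
        simp only [AlgHom.comp_apply, aeval_X]
        have h2 := Ideal.Quotient.eq.mpr (show ratioHom f (f i) (X j) - algebraMap k T (c j) ∈ Q by
          have := hlin j
          rwa [map_sub, algHom_C] at this)
        exact h2
      exact Ideal.Quotient.eq.mp (DFunLike.congr_fun h1 H)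
    refine hdim Q hQp ?_ ?_
    · rw [Ideal.isMaximal_iff]
      refine ⟨fun h => hQp.ne_top ((Ideal.eq_top_iff_one _).mpr (by simpa using h)), ?_⟩
      intro J x hJ hx hxJ
      obtain ⟨H, rfl⟩ := (ratioHom f (f i)).rangeRestrict_surjective x
      have h1 : (ratioHom f (f i)).rangeRestrict H - algebraMap k B (eval c H) ∈ J := hJ (hval H)
      have h2 : algebraMap k B (eval c H) ∈ J := by
        have := J.sub_mem hxJ h1
        rwa [sub_sub_cancel] at this
      have h3 : eval c H ≠ 0 := fun h0 => by
        have := hval H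
        rw [h0, map_zero, sub_zero] at this
        exact hx this
      have h4 := J.mul_mem_left (algebraMap k B (eval c H)⁻¹) h2
      rwa [← map_mul, inv_mul_cancel₀ h3, map_one] at h4
    · intro hGQ
      have h1 := Q.sub_mem (show ratioHom f (f i) G ∈ Q from hGQ) (hval G)
      rw [sub_sub_cancel] at h1
      have h2 : eval c G ≠ 0 := by
        have h3 : eval c (homogenize (X i) G) = eval c G := by
          rw [← aeval_eq_eval]
          refine map_homogenize (aeval c) ?_ G
          rw [aeval_X]
          exact inv_mul_cancel₀ hpi
        rw [← h3, ← aeval_eq_eval, hH.aeval_mul_left, aeval_eq_eval]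
        refine mul_ne_zero (pow_ne_zero _ (inv_ne_zero hpi)) ?_
        rwa [eval_bind₁] at hg
      refine hQp.ne_top ((Ideal.eq_top_iff_one _).mpr ?_)
      have h4 := Q.mul_mem_left (algebraMap k T (eval c G)⁻¹) h1
      rwa [← map_mul, inv_mul_cancel₀ h2, map_one] at h4
  obtain ⟨s, hs⟩ : ∃ s : ℕ∞, (s : WithBot ℕ∞) = ringKrullDim B :=
    WithBot.ne_bot_iff_exists.mp fun h => by
      have := ringKrullDim_nonneg_of_nontrivial (R := B)
      rw [h] at this
      exact absurd this (by simp)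
  change ringKrullDim B ≤ _
  rw [← hs]
  refine WithBot.coe_le_coe.mpr (le_iInf₂ fun Q hQ => ?_)
  exact WithBot.coe_le_coe.mp (hs ▸ hall Q hQ)

theorem forGeneralPoint_height_eq (hf : ∀ i, (f i).IsHomogeneous d) (hne : ∀ i, f i ≠ 0) :
    ForGeneralPoint fun p : Projectivization k (Fin (n + 1) → k) => ∃ hp : IsRegularAt f p,
      topologicalKrullDim (closure (ratImage f)) =
        ((morphismFiberIdeal f (imagePoint f p hp)).height : WithBot ℕ∞) := by
  choose g e hg0 hg hgp using fun i => exists_ringKrullDim_le_height hf (hne i)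
  refine ⟨∏ i, g i * f i, ∑ i, (e i + d), Finset.prod_ne_zero_iff.mpr fun i _ =>
    mul_ne_zero (hg0 i) (hne i), IsHomogeneous.prod _ _ _ fun i _ => (hg i).mul (hf i), ?_⟩
  intro p hp
  rw [map_prod, Finset.prod_ne_zero_iff] at hp
  have hp' (i) : eval p.rep (g i) ≠ 0 ∧ eval p.rep (f i) ≠ 0 := by
    have := hp i (Finset.mem_univ i)
    rw [map_mul] at this
    exact ⟨left_ne_zero_of_mul this, right_ne_zero_of_mul this⟩
  have hreg : IsRegularAt f p := ⟨0, (hp' 0).2⟩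
  refine ⟨hreg, le_antisymm ?_ ?_⟩
  · exact topologicalKrullDim_closure_ratImage_le f hne fun i =>
      hgp i p (hp' i).1 (hp' i).2 hreg
  · exact height_morphismFiberIdeal_le (morphismFiberIdeal_imagePoint_ne_top hf hreg)

end FibreIdeals

end RowIdeals
end

/-! ### Birationality: Cramer's rule for row ideals, and fibres of a birational map. -/

noncomputable section

theorem MvPolynomial.IsHomogeneous.homogeneousComponent_mul {R σ : Type*} [CommSemiring R]
    {d : ℕ} {w : MvPolynomial σ R} (hw : w.IsHomogeneous d) (e : ℕ) (a : MvPolynomial σ R) :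
    homogeneousComponent (e + d) (a * w) = homogeneousComponent e a * w := by
  classical
  conv_lhs => rw [← sum_homogeneousComponent a, Finset.sum_mul, map_sum]
  have h1 (j : ℕ) : homogeneousComponent (e + d) (homogeneousComponent j a * w) =
      if e = j then homogeneousComponent j a * w else 0 := by
    rw [homogeneousComponent_of_mem ((homogeneousComponent_isHomogeneous j a).mul hw)]
    simp
  simp only [h1, Finset.sum_ite_eq, Finset.mem_range]
  split_ifs with h
  · rfl
  · rw [homogeneousComponent_eq_zero _ _ (by omega), zero_mul]

theorem MvPolynomial.IsHomogeneous.exists_eq_sum_C_mul_X {R σ : Type*} [CommSemiring R] [Fintype σ]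
    {a : MvPolynomial σ R} (ha : a.IsHomogeneous 1) : ∃ c : σ → R, a = ∑ b, C (c b) * X b := by
  have h : a ∈ Submodule.span R (Set.range (X : σ → MvPolynomial σ R)) := by
    rw [← homogeneousSubmodule_one_eq_span_X]
    exact ha
  obtain ⟨c, hc⟩ := (Submodule.mem_span_range_iff_exists_fun R).mp h
  exact ⟨c, by simp only [← hc, smul_eq_C_mul]⟩

theorem MvPolynomial.isHomogeneous_det {R σ m : Type*} [CommRing R] [Fintype m] [DecidableEq m]
    {M : Matrix m m (MvPolynomial σ R)} {d : ℕ} (hM : ∀ a b, (M a b).IsHomogeneous d) :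
    M.det.IsHomogeneous (Fintype.card m * d) := by
  rw [Matrix.det_apply']
  refine IsHomogeneous.sum _ _ _ fun s _ => ?_
  have h1 : ((s.sign : ℤ) : MvPolynomial σ R).IsHomogeneous 0 := by
    rw [← map_intCast (C : R →+* MvPolynomial σ R)]
    exact isHomogeneous_C _ _
  have h2 := IsHomogeneous.prod Finset.univ (fun i => M (s i) i) (fun _ => d) fun i _ => hM _ _
  have h3 := h1.mul h2
  rwa [Finset.sum_const, smul_eq_mul, zero_add, Finset.card_univ] at h3

namespace RowIdeals

section Birational

variable {k : Type*} [Field k] {n r d e : ℕ} {f : Fin (r + 1) → MvPolynomial (Fin (n + 1)) k}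

/-- The tuple `g(f)` is proportional to the variables, `x_0 g_i(f) = g_0(f) x_i`; a form of degree
`d` takes the factors out as `d`-th powers. -/
theorem pow_mul_bind₁_bind₁ {g : Fin (n + 1) → MvPolynomial (Fin (r + 1)) k}
    (hmul : ∀ i j, bind₁ f (g i) * X j = bind₁ f (g j) * X i)
    {w : MvPolynomial (Fin (n + 1)) k} (hw : w.IsHomogeneous d) :
    X 0 ^ d * bind₁ f (bind₁ g w) = bind₁ f (g 0) ^ d * w := by
  rw [bind₁_bind₁]
  change X 0 ^ d * aeval (fun i => bind₁ f (g i)) w = _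
  rw [← hw.aeval_mul_left]
  simp_rw [mul_comm (X 0 : MvPolynomial (Fin (n + 1)) k), hmul _ 0]
  rw [hw.aeval_mul_left]
  congr 1
  exact aeval_X_left_apply w

/-- A form-valued left inverse up to a common factor makes `φ` birational onto its image. -/
theorem isBirationalOntoImage_of_mul_X_eq (hf : ∀ i, (f i).IsHomogeneous d) (hne : ∃ i, f i ≠ 0)
    {g : Fin (n + 1) → MvPolynomial (Fin (r + 1)) k} (hg : ∀ i, (g i).IsHomogeneous e)
    (hmul : ∀ i j, bind₁ f (g i) * X j = bind₁ f (g j) * X i)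
    (hg0 : ∃ i, bind₁ f (g i) ≠ 0) : IsBirationalOntoImage f := by
  obtain ⟨i, hi⟩ := hg0
  have h0 : bind₁ f (g 0) ≠ 0 := fun h => by
    have := hmul i 0
    rw [h, zero_mul] at this
    exact mul_ne_zero hi (X_ne_zero _) this
  have hX : (X 0 : MvPolynomial (Fin (n + 1)) k) ^ d ≠ 0 := pow_ne_zero _ (X_ne_zero _)
  have hgf (j) : (bind₁ g (f j)).IsHomogeneous (e * d) := (hf j).aeval g hg
  obtain ⟨j, hj⟩ := id hne
  refine ⟨g, ⟨⟨e, hg⟩, i, fun h => hi ((mem_imageIdeal_iff hne (hg i)).mp h)⟩,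
    ⟨⟨⟨d * e, fun i => (hg i).aeval f hf⟩, i, hi⟩, ⟨⟨1, isHomogeneous_X k⟩, 0, X_ne_zero _⟩,
      fun i j => sub_eq_zero.mpr (hmul i j)⟩,
    ⟨⟨⟨e * d, hgf⟩, j, fun h => ?_⟩, ⟨⟨1, isHomogeneous_X k⟩, j, fun h => hj ?_⟩, fun a b => ?_⟩⟩
  · have h1 := pow_mul_bind₁_bind₁ hmul (hf j)
    rw [(mem_imageIdeal_iff hne (hgf j)).mp h, mul_zero] at h1
    exact mul_ne_zero (pow_ne_zero _ h0) hj h1.symm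
  · simpa using (mem_imageIdeal_iff hne (isHomogeneous_X k j)).mp h
  -- That `φ ∘ ψ` is the identity can be checked after pulling back to `P^n`, where `x_0^d` cancels.
  · rw [mem_imageIdeal_iff hne
      (((hgf a).mul (isHomogeneous_X k b)).sub ((hgf b).mul (isHomogeneous_X k a)))]
    refine (mul_eq_zero.mp ?_).resolve_left hX
    rw [map_sub, map_mul, map_mul, bind₁_X_right, bind₁_X_right, mul_sub, ← mul_assoc, ← mul_assoc,
      pow_mul_bind₁_bind₁ hmul (hf a), pow_mul_bind₁_bind₁ hmul (hf b)]
    ring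

/-- The generators have degree `d`, so only the linear parts of the coefficients matter. -/
theorem TargetPoint.exists_eq_sum_mul_X (hf : ∀ i, (f i).IsHomogeneous d)
    (q : TargetPoint (formSpace f)) {s : MvPolynomial (Fin (n + 1)) k} (hs : s ∈ q.ideal)
    (hd : s.IsHomogeneous (1 + d)) :
    ∃ w : Fin (n + 1) → MvPolynomial (Fin (n + 1)) k, (∀ b, w b ∈ q.space) ∧
      s = ∑ b, w b * X b := by
  obtain ⟨N, a, w, rfl⟩ := Submodule.mem_span_set'.mp hs
  choose c hc using fun i => (homogeneousComponent_isHomogeneous 1 (a i)).exists_eq_sum_C_mul_X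
  refine ⟨fun b => ∑ i, c i b • (w i : MvPolynomial (Fin (n + 1)) k), fun b =>
    Submodule.sum_mem _ fun i _ => Submodule.smul_mem _ _ (w i).2, ?_⟩
  have h1 := homogeneousComponent_of_mem (m := 1 + d) hd
  rw [if_pos rfl, map_sum] at h1
  rw [← h1]
  simp_rw [Finset.sum_mul]
  rw [Finset.sum_comm]
  refine Finset.sum_congr rfl fun i _ => ?_
  rw [smul_eq_mul, (isHomogeneous_of_mem_formSpace hf
    (q.space_le (w i).2)).homogeneousComponent_mul, hc, Finset.sum_mul]
  refine Finset.sum_congr rfl fun b _ => ?_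
  rw [smul_eq_C_mul]
  ring

theorem isBirationalOntoImage_of_rowIdeal (hf : ∀ i, (f i).IsHomogeneous d)
    (q : TargetPoint (formSpace f)) (hlin : IsLinearIdeal (rowIdeal f q))
    (hht : (rowIdeal f q).height = (n : ℕ∞)) (hle : ¬ formIdeal f ≤ rowIdeal f q) :
    IsBirationalOntoImage f := by
  obtain ⟨p, hp, hpq⟩ := exists_eq_pointIdeal hlin hht
  obtain ⟨a₀, ha₀⟩ := Function.ne_iff.mp hp
  rw [Pi.zero_apply] at ha₀
  obtain ⟨h, hW, hq⟩ := q.exists_mem_notMem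
  have hqr : q.ideal ≤ pointIdeal p := by
    rw [← hpq]
    exact fun s hs => Submodule.mem_colon.mpr fun t _ => by
      rw [smul_eq_mul, mul_comm]
      exact Ideal.mul_mem_left _ _ hs
  have hhp : eval p h ≠ 0 := fun h0 => hle <| by
    rw [hpq]
    refine (formIdeal_le_sup hW hq).trans (sup_le hqr ?_)
    rw [Ideal.span_singleton_le_iff_mem]
    exact mem_pointIdeal_of_isHomogeneous hp (isHomogeneous_of_mem_formSpace hf hW) h0
  have hgen (a : Fin (n + 1)) : (C (p a₀) * X a - C (p a) * X a₀) * h ∈ q.ideal := by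
    have := gen_mem_pointIdeal p a₀ a
    rw [← hpq] at this
    exact Submodule.mem_colon.mp this h (mem_formIdeal_of_mem_formSpace hW)
  choose w hwq hw using fun a => q.exists_eq_sum_mul_X hf (hgen a)
    (((isHomogeneous_C_mul_X _ _).sub (isHomogeneous_C_mul_X _ _)).mul
      (isHomogeneous_of_mem_formSpace hf hW))
  choose l hl hlw using fun a b => exists_bind₁_eq_of_mem_formSpace (q.space_le (hwq a b))
  obtain ⟨lh, hlh, hlhh⟩ := exists_bind₁_eq_of_mem_formSpace hW
  have hne : ∃ i, f i ≠ 0 := by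
    by_contra! h0
    refine hle (Ideal.span_le.mpr ?_)
    rintro _ ⟨i, rfl⟩
    rw [h0 i]
    exact Ideal.zero_mem _
  -- Rearranged, the relations read `p_{a₀} h x_a - ∑ w_ab x_b = x_{a₀} p_a h`. `M` and `v` lift
  -- this system to linear forms on `P^r`, so Cramer's rule yields forms of degree `n + 1`.
  let M : Matrix (Fin (n + 1)) (Fin (n + 1)) (MvPolynomial (Fin (r + 1)) k) :=
    Matrix.diagonal (fun _ => C (p a₀) * lh) - Matrix.of l
  let v : Fin (n + 1) → MvPolynomial (Fin (r + 1)) k := fun a => C (p a) * lh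
  let N := M.map (bind₁ f)
  have hClh (c : k) : (C c * lh).IsHomogeneous 1 := by
    simpa using (isHomogeneous_C (Fin (r + 1)) c).mul hlh
  have hM (a b) : (M a b).IsHomogeneous 1 := by
    refine IsHomogeneous.sub ?_ (hl a b)
    rw [Matrix.diagonal_apply]
    split_ifs
    · exact hClh _
    · exact isHomogeneous_zero _ _ _
  have hg (a) : (M.cramer v a).IsHomogeneous (Fintype.card (Fin (n + 1)) * 1) := by
    rw [Matrix.cramer_apply]
    refine isHomogeneous_det fun i j => ?_
    rw [Matrix.updateCol_apply]
    split_ifs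
    · exact hClh _
    · exact hM i j
  have hN : N.mulVec X = (X a₀ : MvPolynomial (Fin (n + 1)) k) • fun a => bind₁ f (v a) := by
    funext a
    have h1 := hw a
    simp only [N, M, v, Matrix.mulVec, dotProduct, Matrix.map_apply, Matrix.sub_apply,
      Matrix.of_apply, map_sub, hlw, sub_mul, Finset.sum_sub_distrib, Pi.smul_apply, smul_eq_mul,
      map_mul, bind₁_C_right, hlhh]
    rw [← h1, Finset.sum_eq_single a]
    · rw [Matrix.diagonal_apply_eq, map_mul, bind₁_C_right, hlhh]
      ring
    · intro b _ hb
      rw [Matrix.diagonal_apply_ne' _ hb, map_zero, zero_mul]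
    · simp
  have hcr (a) : bind₁ f (M.cramer v a) = N.cramer (fun a => bind₁ f (v a)) a := by
    rw [Matrix.cramer_apply, Matrix.cramer_apply, AlgHom.map_det]
    congr 1
    ext i j : 2
    simp only [AlgHom.mapMatrix_apply, Matrix.map_apply, Matrix.updateCol_apply, N]
    split_ifs <;> rfl
  have hdet (a) : N.det * X a = X a₀ * bind₁ f (M.cramer v a) := by
    have h1 : N.cramer (N.mulVec X) = N.det • X := by
      rw [Matrix.cramer_eq_adjugate_mulVec, Matrix.mulVec_mulVec, Matrix.adjugate_mul,
        Matrix.smul_mulVec, Matrix.one_mulVec]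
    rw [hN, map_smul] at h1
    rw [hcr]
    exact (congrFun h1 a).symm
  have hX : (X a₀ : MvPolynomial (Fin (n + 1)) k) ≠ 0 := X_ne_zero _
  -- At `p` every `w a b` vanishes, which leaves the scalar matrix `p_{a₀} h(p)`.
  have hN0 : N.det ≠ 0 := by
    intro h0
    have h1 : eval p N.det = 0 := by rw [h0, map_zero]
    have h2 : (eval p).mapMatrix N = Matrix.diagonal fun _ => p a₀ * eval p h := by
      ext a b
      have h3 : eval p (w a b) = 0 :=
        eval_eq_zero_of_mem_pointIdeal (hqr (Ideal.subset_span (hwq a b)))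
      simp only [RingHom.mapMatrix_apply, Matrix.map_apply, N, M, Matrix.sub_apply, Matrix.of_apply,
        map_sub, hlw, h3, sub_zero, Matrix.diagonal_apply]
      split_ifs
      · rw [map_mul, map_mul, bind₁_C_right, hlhh, eval_C]
      · simp
    rw [RingHom.map_det, h2, Matrix.det_diagonal, Finset.prod_eq_zero_iff] at h1
    obtain ⟨_, _, h1⟩ := h1
    exact mul_ne_zero ha₀ hhp h1
  refine isBirationalOntoImage_of_mul_X_eq hf hne hg (fun i j => ?_) ⟨a₀, fun h0 => ?_⟩
  · refine mul_left_cancel₀ hX ?_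
    rw [← mul_assoc, ← mul_assoc, ← hdet, ← hdet]
    ring
  · have := hdet a₀
    rw [h0, mul_zero] at this
    exact mul_ne_zero hN0 hX this

theorem IsBirationalOntoImage.forGeneralPoint (hf : ∀ i, (f i).IsHomogeneous d)
    (hne : ∃ i, f i ≠ 0) (hbir : IsBirationalOntoImage f) :
    ForGeneralPoint fun p : Projectivization k (Fin (n + 1) → k) => ∃ hp : IsRegularAt f p,
      morphismFiberIdeal f (imagePoint f p hp) = pointIdeal p.rep ∧
        (pointIdeal p.rep).height = (n : ℕ∞) := by
  obtain ⟨i, hi⟩ := hne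
  obtain ⟨g, ⟨⟨e, hg⟩, -⟩, ⟨⟨-, a, ha⟩, -, hmul⟩, -⟩ := hbir
  replace hmul (a b) : bind₁ f (g a) * X b = bind₁ f (g b) * X a := sub_eq_zero.mp (hmul a b)
  have h0 : bind₁ f (g 0) ≠ 0 := fun h => by
    have := hmul a 0
    rw [h, zero_mul] at this
    exact mul_ne_zero ha (X_ne_zero _) this
  refine ⟨X 0 * f i * bind₁ f (g 0), 1 + d + d * e, mul_ne_zero (mul_ne_zero (X_ne_zero _) hi) h0,
    ((isHomogeneous_X k 0).mul (hf i)).mul ((hg 0).aeval f hf), fun p hp => ?_⟩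
  rw [map_mul, map_mul, eval_X, eval_bind₁] at hp
  obtain ⟨⟨hp0, hpi⟩, hpg⟩ : (p.rep 0 ≠ 0 ∧ eval p.rep (f i) ≠ 0) ∧
      eval (fun j => eval p.rep (f j)) (g 0) ≠ 0 :=
    ⟨⟨left_ne_zero_of_mul (left_ne_zero_of_mul hp), right_ne_zero_of_mul (left_ne_zero_of_mul hp)⟩,
      right_ne_zero_of_mul hp⟩
  have hreg : IsRegularAt f p := ⟨i, hpi⟩
  refine ⟨hreg, le_antisymm (morphismFiberIdeal_imagePoint_le hf hreg) (Ideal.span_le.mpr ?_),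
    height_pointIdeal hp0⟩
  rintro _ ⟨⟨a, b⟩, rfl⟩
  have hiq : f i ∉ (imagePoint f p hreg).space := fun h => hpi ((mem_imagePoint_space hreg).mp h).2
  refine (mem_morphismFiberIdeal_iff (mem_formSpace f i) hiq _).mpr ⟨e, ?_⟩
  let c : Fin (r + 1) → k := fun j => eval p.rep (f j)
  let π := Ideal.Quotient.mkₐ k (imagePoint f p hreg).ideal
  -- Modulo `I_φ(p)` the tuple `f` is proportional to its value `c` at `p`. Hence `g(f)` is
  -- proportional to `g(c)`, which is itself proportional to `p`.
  have hπf (j) : π (C (c i)) * π (f j) = π (f i) * algebraMap k _ (c j) := by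
    rw [← AlgHom.commutes π, ← map_mul, ← map_mul]
    refine Ideal.Quotient.eq.mpr (Ideal.subset_span ?_)
    rw [SetLike.mem_coe, mem_imagePoint_space, algebraMap_eq, mul_comm (f i), ← smul_eq_C_mul,
      ← smul_eq_C_mul]
    refine ⟨Submodule.sub_mem _ (Submodule.smul_mem _ _ (mem_formSpace f j))
      (Submodule.smul_mem _ _ (mem_formSpace f i)), ?_⟩
    rw [map_sub, smul_eval, smul_eval]
    simp only [c]
    ring
  have hπg (a) : π (C (c i)) ^ e * π (bind₁ f (g a)) = π (f i) ^ e * π (C (eval c (g a))) := by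
    have h1 : π (bind₁ f (g a)) = aeval (fun j => π (f j)) (g a) := by
      change π (aeval f (g a)) = _
      rw [← comp_aeval_apply]
    rw [h1, ← (hg a).aeval_mul_left]
    simp_rw [hπf]
    rw [(hg a).aeval_mul_left]
    congr 1
    exact (aeval_algebraMap_apply _ c (g a)).trans (π.commutes _).symm
  have hγ (a) : eval c (g a) * p.rep 0 = eval c (g 0) * p.rep a := by
    have := congrArg (eval p.rep) (hmul a 0)
    rwa [map_mul, map_mul, eval_X, eval_X, eval_bind₁, eval_bind₁] at this
  have hmain : π (f i ^ e * (C (eval c (g a)) * X b - C (eval c (g b)) * X a)) = 0 := by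
    have h1 := congrArg (fun s => π (C (c i)) ^ e * π s) (hmul a b)
    simp only [map_mul, ← mul_assoc, hπg] at h1
    rw [map_mul, map_sub, map_mul, map_mul, map_pow, mul_sub, ← mul_assoc, ← mul_assoc, h1, sub_self]
  have hmem := Ideal.mul_mem_left _ (C (p.rep 0 * (eval c (g 0))⁻¹))
    (Ideal.Quotient.eq_zero_iff_mem.mp hmain)
  have hC (a) : p.rep 0 * (eval c (g 0))⁻¹ * eval c (g a) = p.rep a := by
    have h2 : eval c (g 0) ≠ 0 := hpg
    field_simp
    rw [mul_comm, hγ a]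
  convert hmem using 1
  change _ * (C (p.rep a) * X b - C (p.rep b) * X a) = _
  rw [show p.rep a = _ from (hC a).symm, show p.rep b = _ from (hC b).symm]
  simp only [C_mul]
  ring

end Birational

end RowIdeals
end

/-! ### The affine cone over the map, and birationality from general fibres. -/

noncomputable section

namespace RowIdeals

section Dehomogenization

variable {k : Type*} [Field k] {n r d e : ℕ} {f : Fin (r + 1) → MvPolynomial (Fin (n + 1)) k}

/-- Setting `x_0 = 1`. -/
def dehomogenize : MvPolynomial (Fin (n + 1)) k →ₐ[k] MvPolynomial (Fin (n + 1)) k :=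
  aeval (Fin.cons 1 fun a => X a.succ)

theorem dehomogenize_X_zero : dehomogenize (X 0 : MvPolynomial (Fin (n + 1)) k) = 1 := by
  rw [dehomogenize, aeval_X, Fin.cons_zero]

theorem dehomogenize_X_succ (a : Fin n) :
    dehomogenize (X a.succ : MvPolynomial (Fin (n + 1)) k) = X a.succ := by
  rw [dehomogenize, aeval_X, Fin.cons_succ]

theorem eval_dehomogenize (v : Fin (n + 1) → k) (s : MvPolynomial (Fin (n + 1)) k) :
    eval v (dehomogenize s) = eval (Fin.cons 1 fun a => v a.succ) s := by
  have h : (aeval v).comp (dehomogenize (k := k) (n := n)) =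
      aeval (Fin.cons 1 fun a => v a.succ) := by
    ext1 i
    rw [AlgHom.comp_apply, aeval_X]
    refine Fin.cases ?_ (fun a => ?_) i
    · rw [dehomogenize_X_zero, map_one, Fin.cons_zero]
    · rw [dehomogenize_X_succ, aeval_X, Fin.cons_succ]
  exact DFunLike.congr_fun h s

theorem eval_eq_pow_mul_eval_dehomogenize {s : MvPolynomial (Fin (n + 1)) k}
    (hs : s.IsHomogeneous e) {v : Fin (n + 1) → k} (hv : v 0 ≠ 0) :
    eval v s = v 0 ^ e * eval (fun i => (v 0)⁻¹ * v i) (dehomogenize s) := by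
  rw [eval_dehomogenize]
  conv_lhs => rw [show v = fun i => v 0 * (Fin.cons 1 (fun a => (v 0)⁻¹ * v a.succ) :
    Fin (n + 1) → k) i from funext fun i => by
      refine Fin.cases ?_ (fun a => ?_) i
      · simp
      · simp [hv]]
  rw [← aeval_eq_eval, hs.aeval_mul_left]
  simp

variable [Infinite k]

theorem exists_eval_ne_zero {s : MvPolynomial (Fin (n + 1)) k} (hs : s ≠ 0) :
    ∃ v : Fin (n + 1) → k, eval v s ≠ 0 := by
  by_contra! h
  exact hs (MvPolynomial.funext fun v => by rw [h v, map_zero])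

/-- The form vanishes wherever `x_0 ≠ 0`, which suffices over an infinite field. -/
theorem eq_zero_of_dehomogenize_eq_zero {s : MvPolynomial (Fin (n + 1)) k}
    (hs : s.IsHomogeneous e) (h0 : dehomogenize s = 0) : s = 0 := by
  by_contra hne
  obtain ⟨v, hv⟩ := exists_eval_ne_zero (mul_ne_zero (X_ne_zero 0) hne)
  rw [map_mul, eval_X] at hv
  refine right_ne_zero_of_mul hv ?_
  rw [eval_eq_pow_mul_eval_dehomogenize hs (left_ne_zero_of_mul hv), h0, map_zero, mul_zero]

end Dehomogenization

section Cone

variable {k : Type*} [Field k] {n r d e : ℕ} {f : Fin (r + 1) → MvPolynomial (Fin (n + 1)) k}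

/-- The affine cone over `φ`, in the coordinates `x_0` (scaling) and `x_a / x_0`. -/
def coneHom (f : Fin (r + 1) → MvPolynomial (Fin (n + 1)) k) :
    MvPolynomial (Fin (r + 1)) k →ₐ[k] MvPolynomial (Fin (n + 1)) k :=
  aeval fun j => X 0 * dehomogenize (f j)

theorem coneHom_of_isHomogeneous {G : MvPolynomial (Fin (r + 1)) k} (hG : G.IsHomogeneous e) :
    coneHom f G = X 0 ^ e * dehomogenize (bind₁ f G) := by
  rw [coneHom, hG.aeval_mul_left]
  congr 1
  exact (comp_aeval_apply (φ := dehomogenize) (f := f) G).symm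

theorem coneHom_eq_sum (G : MvPolynomial (Fin (r + 1)) k) :
    coneHom f G = ∑ e ∈ Finset.range (G.totalDegree + 1),
      X 0 ^ e * dehomogenize (bind₁ f (homogeneousComponent e G)) := by
  conv_lhs => rw [← sum_homogeneousComponent G, map_sum]
  exact Finset.sum_congr rfl fun e _ =>
    coneHom_of_isHomogeneous (homogeneousComponent_isHomogeneous e G)

/-- Polynomials viewed as polynomials in `x_0`. -/
def expandZero : MvPolynomial (Fin (n + 1)) k →ₐ[k] Polynomial (MvPolynomial (Fin (n + 1)) k) :=
  aeval (Fin.cons Polynomial.X fun a => Polynomial.C (X a.succ))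

theorem expandZero_dehomogenize (s : MvPolynomial (Fin (n + 1)) k) :
    expandZero (dehomogenize s) = Polynomial.C (dehomogenize s) := by
  have h : (expandZero (k := k) (n := n)).comp dehomogenize =
      ((Algebra.ofId (MvPolynomial (Fin (n + 1)) k) (Polynomial _)).restrictScalars k).comp
        dehomogenize := by
    ext1 i
    rw [AlgHom.comp_apply, AlgHom.comp_apply]
    refine Fin.cases ?_ (fun a => ?_) i
    · rw [dehomogenize_X_zero, map_one, map_one]
    · rw [dehomogenize_X_succ, expandZero, aeval_X, Fin.cons_succ]
      rfl
  exact DFunLike.congr_fun h s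

/-- Dehomogenized forms do not involve `x_0`, so the power of `x_0` records the degree and separates
the homogeneous parts of `G`. -/
theorem coeff_expandZero_coneHom (G : MvPolynomial (Fin (r + 1)) k) (e : ℕ) :
    (expandZero (coneHom f G)).coeff e = dehomogenize (bind₁ f (homogeneousComponent e G)) := by
  rw [coneHom_eq_sum, map_sum, Polynomial.finsetSum_coeff]
  have h1 (j : ℕ) : (expandZero (X 0 ^ j *
      dehomogenize (bind₁ f (homogeneousComponent j G)))).coeff e =
        if e = j then dehomogenize (bind₁ f (homogeneousComponent j G)) else 0 := by
    rw [map_mul, map_pow, expandZero_dehomogenize, expandZero, aeval_X, Fin.cons_zero,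
      Polynomial.coeff_mul_C, Polynomial.coeff_X_pow]
    split_ifs <;> simp
  simp only [h1, Finset.sum_ite_eq, Finset.mem_range]
  split_ifs with h
  · rfl
  · rw [homogeneousComponent_eq_zero _ _ (by omega), map_zero, map_zero]

theorem expandZero_X_succ (a : Fin n) :
    expandZero (X a.succ : MvPolynomial (Fin (n + 1)) k) = Polynomial.C (X a.succ) := by
  rw [expandZero, aeval_X, Fin.cons_succ]

/-- A point at which the saturated fibre ideal is the ideal of the point lies in an unramified
one-point fibre of the affine cone over `φ`. -/
theorem ker_aeval_le_map_under {P v : Fin (n + 1) → k} (hP : P 0 ≠ 0)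
    (hv : v = Fin.cons 1 fun a => P a.succ) (q : TargetPoint (formSpace f))
    (hq : ∀ w ∈ q.space, eval v w = 0) {i : Fin (r + 1)} (hi : eval v (f i) ≠ 0)
    (hle : pointIdeal v ≤ morphismFiberIdeal f q) :
    RingHom.ker (aeval P : MvPolynomial (Fin (n + 1)) k →ₐ[k] k) ≤
      ((RingHom.ker (aeval P : MvPolynomial (Fin (n + 1)) k →ₐ[k] k)).under
        (coneHom f).range).map
      (algebraMap (coneHom f).range (MvPolynomial (Fin (n + 1)) k)) := by
  let J := ((RingHom.ker (aeval P : MvPolynomial (Fin (n + 1)) k →ₐ[k] k)).under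
    (coneHom f).range).map
      (algebraMap (coneHom f).range (MvPolynomial (Fin (n + 1)) k))
  let π := Ideal.Quotient.mkₐ k J
  have hPv (s) : eval P (dehomogenize s) = eval v s := by rw [eval_dehomogenize, hv]
  have hcone (l : MvPolynomial (Fin (r + 1)) k) : coneHom f l - C (eval P (coneHom f l)) ∈ J := by
    have hmem : (coneHom f).rangeRestrict (l - C (eval P (coneHom f l))) ∈
        (RingHom.ker (aeval P : MvPolynomial (Fin (n + 1)) k →ₐ[k] k)).under
          (coneHom f).range := by
      change aeval P (coneHom f (l - C (eval P (coneHom f l)))) = 0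
      rw [map_sub, map_sub, algHom_C, AlgHom.commutes, aeval_eq_eval]
      simp
    have h1 : coneHom f (l - C (eval P (coneHom f l))) ∈ J :=
      Ideal.mem_map_of_mem (algebraMap (coneHom f).range (MvPolynomial (Fin (n + 1)) k)) hmem
    rwa [map_sub, algHom_C] at h1
  have hform {w} (hw : w ∈ formSpace f) : π (X 0) * π (dehomogenize w) =
      algebraMap k _ (P 0 * eval v w) := by
    obtain ⟨l, hl, rfl⟩ := exists_bind₁_eq_of_mem_formSpace hw
    have h1 := hcone l
    rw [coneHom_of_isHomogeneous hl, pow_one, map_mul, eval_X, hPv] at h1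
    rw [← map_mul]
    exact Ideal.Quotient.eq.mpr h1
  have hideal {s} (hs : s ∈ q.ideal) : π (X 0) * π (dehomogenize s) = 0 := by
    refine Submodule.span_induction (fun w hw => ?_) (by simp) (fun x y _ _ hx hy => ?_)
      (fun a x _ hx => ?_) hs
    · rw [hform (q.space_le hw), hq w hw, mul_zero, map_zero]
    · rw [map_add, map_add, mul_add, hx, hy, add_zero]
    · rw [smul_eq_mul, map_mul, map_mul, mul_left_comm, hx, mul_zero]
  have hiq : f i ∉ q.space := fun h => hi (hq _ h)
  have hunit : IsUnit (π (X 0) * π (dehomogenize (f i))) := by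
    rw [hform (mem_formSpace f i)]
    exact (IsUnit.mk0 _ (mul_ne_zero hP hi)).map _
  -- In the fibre ring `x_0` and `f_i` are units while `W_q` vanishes, so the saturated equations of
  -- the point hold without their factor `f_i^m`.
  have hsucc (a : Fin n) : π (X a.succ) = algebraMap k _ (P a.succ) := by
    obtain ⟨m, hm⟩ := (mem_morphismFiberIdeal_iff (mem_formSpace f i) hiq _).mp
      (hle (gen_mem_pointIdeal v 0 a.succ))
    have h1 := hideal hm
    have hv0 : v 0 = 1 := by rw [hv, Fin.cons_zero]
    have hva : v a.succ = P a.succ := by rw [hv, Fin.cons_succ]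
    rw [hv0, hva, C_1, one_mul, map_mul, map_pow, map_sub, map_mul dehomogenize (C _),
      dehomogenize_X_succ, dehomogenize_X_zero, algHom_C, mul_one, map_mul, map_pow, map_sub,
      AlgHom.commutes, ← mul_assoc] at h1
    have hu : IsUnit (π (X 0) * π (dehomogenize (f i)) ^ m) :=
      (isUnit_of_mul_isUnit_left hunit).mul ((isUnit_of_mul_isUnit_right hunit).pow m)
    exact sub_eq_zero.mp ((hu.mul_right_eq_zero).mp h1)
  have hdeh (s) : π (dehomogenize s) = algebraMap k _ (eval v s) := by
    have h1 : π.comp dehomogenize = (Algebra.ofId k _).comp (aeval v) := by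
      ext1 j
      rw [AlgHom.comp_apply, AlgHom.comp_apply, aeval_X, hv]
      refine Fin.cases ?_ (fun a => ?_) j
      · rw [dehomogenize_X_zero, Fin.cons_zero, map_one, map_one]
      · rw [dehomogenize_X_succ, Fin.cons_succ, hsucc]
        rfl
    exact DFunLike.congr_fun h1 s
  have hzero : π (X 0) = algebraMap k _ (P 0) := by
    have h1 := hform (mem_formSpace f i)
    rw [hdeh, map_mul] at h1
    exact ((IsUnit.mk0 _ hi).map (algebraMap k _)).mul_right_cancel h1
  intro s hs
  have h1 : π = (Algebra.ofId k _).comp (aeval P) := by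
    ext1 j
    rw [AlgHom.comp_apply, aeval_X]
    refine Fin.cases ?_ (fun a => ?_) j
    · exact hzero
    · exact hsucc a
  refine Ideal.Quotient.eq_zero_iff_mem.mp (?_ : π s = 0)
  rw [h1, AlgHom.comp_apply, RingHom.mem_ker.mp hs, map_zero]

/-- Comparing coefficients of one power `x_0^e` turns the relations into relations between forms of
degree `e`, with `e` chosen so that the component of `D` survives on the image. -/
theorem isBirationalOntoImage_of_coneHom [Infinite k] (hf : ∀ i, (f i).IsHomogeneous d)
    (hne : ∃ i, f i ≠ 0) {D : MvPolynomial (Fin (r + 1)) k}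
    {c : Fin n → MvPolynomial (Fin (r + 1)) k} (hD : coneHom f D ≠ 0)
    (hc : ∀ a, coneHom f D * X a.succ = coneHom f (c a)) : IsBirationalOntoImage f := by
  obtain ⟨e, he⟩ : ∃ e, bind₁ f (homogeneousComponent e D) ≠ 0 := by
    by_contra! h
    refine hD ?_
    rw [coneHom_eq_sum]
    exact Finset.sum_eq_zero fun e _ => by rw [h e, map_zero, mul_zero]
  let g : Fin (n + 1) → MvPolynomial (Fin (r + 1)) k :=
    Fin.cons (homogeneousComponent e D) fun a => homogeneousComponent e (c a)
  have hg (a) : (g a).IsHomogeneous e := by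
    refine Fin.cases ?_ (fun a => ?_) a
    · exact homogeneousComponent_isHomogeneous e D
    · exact homogeneousComponent_isHomogeneous e (c a)
  have hgf (a) : (bind₁ f (g a)).IsHomogeneous (d * e) := (hg a).aeval f hf
  have h0 (a : Fin (n + 1)) : bind₁ f (g 0) * X a = bind₁ f (g a) * X 0 := by
    refine Fin.cases rfl (fun a => ?_) a
    rw [← sub_eq_zero]
    refine eq_zero_of_dehomogenize_eq_zero (((hgf 0).mul (isHomogeneous_X k _)).sub
      ((hgf a.succ).mul (isHomogeneous_X k _))) ?_
    rw [map_sub, map_mul, map_mul, dehomogenize_X_zero, dehomogenize_X_succ, mul_one, sub_eq_zero]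
    have h1 := congrArg (fun s => (expandZero s).coeff e) (hc a)
    simp only [map_mul, expandZero_X_succ, Polynomial.coeff_mul_C, coeff_expandZero_coneHom] at h1
    exact h1
  refine isBirationalOntoImage_of_mul_X_eq hf hne hg (fun i j => ?_) ⟨0, he⟩
  refine mul_left_cancel₀ (X_ne_zero 0 : (X 0 : MvPolynomial (Fin (n + 1)) k) ≠ 0) ?_
  rw [← mul_assoc, ← mul_assoc, mul_comm (X 0), mul_comm (X 0), ← h0, ← h0]
  ring

theorem isBirationalOntoImage_of_forGeneralPoint [Infinite k] (hf : ∀ i, (f i).IsHomogeneous d)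
    (hne : ∃ i, f i ≠ 0)
    (hgen : ForGeneralPoint fun p : Projectivization k (Fin (n + 1) → k) =>
      ∃ hp : IsRegularAt f p, IsLinearIdeal (morphismFiberIdeal f (imagePoint f p hp)) ∧
        (morphismFiberIdeal f (imagePoint f p hp)).height = (n : ℕ∞)) :
    IsBirationalOntoImage f := by
  obtain ⟨i, hi⟩ := id hne
  obtain ⟨g, e, hg0, hg, hgp⟩ := hgen
  have hfib (P : Fin (n + 1) → k) (hP : P 0 ≠ 0) (hPg : eval P (dehomogenize g) ≠ 0)
      (hPi : eval P (dehomogenize (f i)) ≠ 0) :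
      RingHom.ker (aeval P : MvPolynomial (Fin (n + 1)) k →ₐ[k] k) ≤
      ((RingHom.ker (aeval P : MvPolynomial (Fin (n + 1)) k →ₐ[k] k)).under
        (coneHom f).range).map
      (algebraMap (coneHom f).range (MvPolynomial (Fin (n + 1)) k)) := by
    rw [eval_dehomogenize] at hPg hPi
    let v : Fin (n + 1) → k := Fin.cons 1 fun a => P a.succ
    have hv0 : v 0 = 1 := Fin.cons_zero _ _
    have hv : v ≠ 0 := fun h => one_ne_zero (α := k) (by rw [← hv0, h, Pi.zero_apply])
    let p := Projectivization.mk k v hv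
    obtain ⟨c, hc⟩ := Projectivization.exists_smul_eq_mk_rep k v hv
    have hrep {s : MvPolynomial (Fin (n + 1)) k} {m : ℕ} (hs : s.IsHomogeneous m) :
        eval p.rep s = (c : k) ^ m * eval v s := by
      rw [show p.rep = fun j => (c : k) * v j from hc.symm, ← aeval_eq_eval, hs.aeval_mul_left]
      rfl
    obtain ⟨hp, hlin, hht⟩ := hgp p (by
      rw [hrep hg]
      exact mul_ne_zero (pow_ne_zero _ c.ne_zero) hPg)
    refine ker_aeval_le_map_under hP rfl (imagePoint f p hp) (fun w hw => ?_) hPi ?_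
    · obtain ⟨hw, h0⟩ := (mem_imagePoint_space hp).mp hw
      rw [hrep (isHomogeneous_of_mem_formSpace hf hw)] at h0
      exact (mul_eq_zero.mp h0).resolve_left (pow_ne_zero _ c.ne_zero)
    -- The fibre ideal is the ideal of some point `p'` and lies in the ideal of `p`, so `p'` is
    -- proportional to `p`.
    · obtain ⟨p', hp', heq⟩ := exists_eq_pointIdeal hlin hht
      have hprop (j) : p' j = p' 0 * v j := by
        have h1 := gen_mem_pointIdeal p' 0 j
        rw [← heq] at h1
        have h2 := eval_eq_zero_of_mem_pointIdeal (morphismFiberIdeal_imagePoint_le hf hp h1)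
        rw [hrep ((isHomogeneous_C_mul_X _ _).sub (isHomogeneous_C_mul_X _ _))] at h2
        have h3 := (mul_eq_zero.mp h2).resolve_left (pow_ne_zero _ c.ne_zero)
        rw [map_sub, map_mul, map_mul, eval_C, eval_C, eval_X, eval_X, hv0, mul_one] at h3
        exact (sub_eq_zero.mp h3).symm
      have hp0 : p' 0 ≠ 0 := fun h0 => hp' (funext fun j => by
        rw [hprop j, h0, zero_mul, Pi.zero_apply])
      rw [heq, show p' = p' 0 • v from funext hprop, pointIdeal_smul hp0]
  -- The field is infinite, so a rational point avoids finitely many hypersurfaces. This is used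
  -- first to get algebraicity, then again to avoid the `b` that depends on it.
  have hex {b : MvPolynomial (Fin (n + 1)) k} (hb : b ≠ 0) : ∃ P : Fin (n + 1) → k, P 0 ≠ 0 ∧
      eval P (dehomogenize g) ≠ 0 ∧ eval P (dehomogenize (f i)) ≠ 0 ∧ eval P b ≠ 0 := by
    obtain ⟨P, hP⟩ := exists_eval_ne_zero (mul_ne_zero (mul_ne_zero (mul_ne_zero
      (X_ne_zero (0 : Fin (n + 1)) : (X 0 : MvPolynomial (Fin (n + 1)) k) ≠ 0)
        (fun h => hg0 (eq_zero_of_dehomogenize_eq_zero hg h)))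
        (fun h => hi (eq_zero_of_dehomogenize_eq_zero (hf i) h))) hb)
    simp only [map_mul, eval_X, mul_ne_zero_iff] at hP
    exact ⟨P, hP.1.1.1, hP.1.1.2, hP.1.2, hP.2⟩
  have hft : Algebra.FiniteType k (coneHom f).range :=
    .of_surjective (coneHom f).rangeRestrict (coneHom f).rangeRestrict_surjective
  have halg : Algebra.IsAlgebraic (coneHom f).range (MvPolynomial (Fin (n + 1)) k) := by
    obtain ⟨P, h0, h1, h2, -⟩ := hex one_ne_zero
    have hmax : (RingHom.ker (aeval P : MvPolynomial (Fin (n + 1)) k →ₐ[k] k)).IsMaximal :=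
      RingHom.ker_isMaximal_of_surjective _ fun x => ⟨C x, by simp⟩
    exact MvPolynomial.isAlgebraic_of_isMaximal_le_map _ (hfib P h0 h1 h2)
  classical
  let t : Finset (MvPolynomial (Fin (n + 1)) k) := Finset.univ.image X
  have ht : Algebra.adjoin (coneHom f).range (t : Set (MvPolynomial (Fin (n + 1)) k)) = ⊤ := by
    refine eq_top_iff.mpr fun s _ => ?_
    induction s using MvPolynomial.induction_on with
    | C a => exact Subalgebra.algebraMap_mem _ (algebraMap k (coneHom f).range a)
    | add x y hx hy => exact add_mem (hx trivial) (hy trivial)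
    | mul_X x j hx =>
      exact mul_mem (hx trivial) (Algebra.subset_adjoin (by simp [t]))
  obtain ⟨b, hb, hbπ⟩ := exists_ne_zero_forall_exists_mul_mem (k := k) t ht
  obtain ⟨P, h0, h1, h2, h3⟩ := hex (b := b.1) fun h => hb (Subtype.ext h)
  obtain ⟨⟨_, D, rfl⟩, hD, hDt⟩ := hbπ (aeval P) h3 (hfib P h0 h1 h2)
  have hX (a : Fin n) : ∃ c, coneHom f D * X a.succ = coneHom f c := by
    obtain ⟨⟨_, c, rfl⟩, hc⟩ := hDt (X a.succ) (by simp [t])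
    exact ⟨c, hc⟩
  choose c hc using hX
  refine isBirationalOntoImage_of_coneHom hf hne (D := D) (fun h => hD ?_) hc
  change aeval P (coneHom f D) = 0
  rw [h, map_zero]

end Cone

end RowIdeals
end

theorem mainTheorem2 {k : Type*} [Field k] [Infinite k] {n r d : ℕ}
    (f : Fin (r + 1) → MvPolynomial (Fin (n + 1)) k)
    (hf : ∀ i, (f i).IsHomogeneous d)
    (hli : LinearIndependent k f)
    (hcodim : 2 ≤ (RowIdeals.formIdeal f).height) :
    (∀ q : RowIdeals.TargetPoint (RowIdeals.formSpace f),
      RowIdeals.morphismFiberIdeal f q ≠ ⊤ →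
        1 + ((RowIdeals.morphismFiberIdeal f q).height : WithBot ℕ∞) ≤
          RowIdeals.analyticSpread f) ∧
    (RowIdeals.ForGeneralPoint fun p : Projectivization k (Fin (n + 1) → k) =>
      ∃ hp : RowIdeals.IsRegularAt f p,
        RowIdeals.analyticSpread f =
          1 + ((RowIdeals.morphismFiberIdeal f (RowIdeals.imagePoint f p hp)).height :
            WithBot ℕ∞)) ∧
    ((∃ q : RowIdeals.TargetPoint (RowIdeals.formSpace f),
        RowIdeals.IsLinearIdeal (RowIdeals.rowIdeal f q) ∧
        (RowIdeals.rowIdeal f q).height = (n : ℕ∞) ∧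
        ¬ RowIdeals.formIdeal f ≤ RowIdeals.rowIdeal f q) →
      RowIdeals.IsBirationalOntoImage f) ∧
    (RowIdeals.IsBirationalOntoImage f ↔
      RowIdeals.ForGeneralPoint fun p : Projectivization k (Fin (n + 1) → k) =>
        ∃ hp : RowIdeals.IsRegularAt f p,
          RowIdeals.IsLinearIdeal
            (RowIdeals.morphismFiberIdeal f (RowIdeals.imagePoint f p hp)) ∧
          (RowIdeals.morphismFiberIdeal f (RowIdeals.imagePoint f p hp)).height =
            (n : ℕ∞)) := by
  have hne (i) : f i ≠ 0 := hli.ne_zero i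
  refine ⟨fun q hq => add_le_add le_rfl (RowIdeals.height_morphismFiberIdeal_le hq), ?_, ?_, ?_, ?_⟩
  · obtain ⟨g, e, hg0, hg, hgp⟩ := RowIdeals.forGeneralPoint_height_eq hf hne
    refine ⟨g, e, hg0, hg, fun p hp => ?_⟩
    obtain ⟨hreg, h⟩ := hgp p hp
    exact ⟨hreg, by rw [RowIdeals.analyticSpread, h]⟩
  · rintro ⟨q, hlin, hht, hle⟩
    exact RowIdeals.isBirationalOntoImage_of_rowIdeal hf q hlin hht hle
  · intro hbir
    obtain ⟨g, e, hg0, hg, hgp⟩ := hbir.forGeneralPoint hf ⟨0, hne 0⟩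
    refine ⟨g, e, hg0, hg, fun p hp => ?_⟩
    obtain ⟨hreg, h, hht⟩ := hgp p hp
    exact ⟨hreg, h ▸ RowIdeals.isLinearIdeal_pointIdeal _, h ▸ hht⟩
  · exact RowIdeals.isBirationalOntoImage_of_forGeneralPoint hf ⟨0, hne 0⟩
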